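/- All schemes below are understood as follows. A \emph{Dedekind scheme} is an irreducible, Noetherian and normal scheme of dimension one. For an integral scheme $S$ with function field $K$ and an $S$-scheme $Y$, write $Y_K = Y\times_S \operatorname{Spec} K$ for the generic fiber. A separated, flat $S$-scheme $X$ of finite type has the \emph{weak extension property} if for every smooth $S$-scheme $Z$ and every $K$-morphism $u_K\colon Z_K\to X_K$ there is an $S$-morphism $u\colon Z\to X$ extending $u_K$. If $S$ is a Dedekind scheme, $X$ satisfies the weak extension property \emph{universally} if it has the weak extension property over $S$ and, for every Dedekind scheme $S'$ and every morphism $S'\to S$ of finite type, $X\times_S S'$ has the weak extension property over $S'$. A scheme $V$ over an algebraically closed field $k$ \emph{contains a rational curve} if some locally closed subscheme of $V$ is isomorphic over $k$ to a dense open subscheme of $\mathbb{P}^1_k$. \textbf{Lemma.} Let $S$ be a Dedekind scheme with function field $K$, and let $X_K$ be a smooth and separated $K$-scheme of finite type. Suppose that $X_K$ has a proper $S$-model satisfying the weak extension property universally, i.e. there is a proper and flat $S$-scheme $X$ whose generic fiber is isomorphic to $X_K$ over $K$ and which satisfies the weak extension property universally. Then $X_K$ contains no rational curve, in the geometric sense: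 if $\overline{K}$ is an algebraic closure of $K$, then $X_{\overline{K}} = X_K\times_{\operatorname{Spec} K}\operatorname{Spec}\overline{K}$ contains no rational curve. -/

import Mathlib

open CategoryTheory CategoryTheory.Limits AlgebraicGeometry

universe u

namespace PseudoNeron

/-- A Dedekind scheme: an irreducible, Noetherian and normal scheme of dimension one.
An irreducible scheme whose local rings are integrally closed domains is integral, so
irreducibility together with the reducedness contained in normality is recorded as `IsIntegral`. -/
class IsDedekindScheme (S : Scheme.{u}) : Prop extends IsIntegral S, IsNoetherian S where
  isIntegrallyClosed_stalk : ∀ s : S, IsIntegrallyClosed (S.presheaf.stalk s)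
  topologicalKrullDim_eq_one : topologicalKrullDim S = 1

/-- The inclusion `Spec K ⟶ S` of the generic point of an integral scheme, where `K` is the
function field of `S`. -/
noncomputable def genericPointMap (S : Scheme.{u}) [IsIntegral S] : Spec S.functionField ⟶ S :=
  S.fromSpecStalk (genericPoint S)

/-- The generic fiber `X_K` of an `S`-scheme `f : X ⟶ S`. -/
noncomputable def genericFiber {X S : Scheme.{u}} [IsIntegral S] (f : X ⟶ S) : Scheme.{u} :=
  pullback f (genericPointMap S)

/-- The structure morphism `X_K ⟶ Spec K` of the generic fiber. -/
noncomputable def genericFiberToSpec {X S : Scheme.{u}} [IsIntegral S] (f : X ⟶ S) :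
    genericFiber f ⟶ Spec S.functionField :=
  pullback.snd f (genericPointMap S)

/-- The projection `X_K ⟶ X` from the generic fiber. -/
noncomputable def genericFiberι {X S : Scheme.{u}} [IsIntegral S] (f : X ⟶ S) :
    genericFiber f ⟶ X :=
  pullback.fst f (genericPointMap S)

/-- The weak extension property of an `S`-scheme `f : X ⟶ S` (intended for `f` separated, flat and
of finite type): for every smooth `S`-scheme `g : Z ⟶ S`, every `K`-morphism `uK : Z_K ⟶ X_K`
extends to an `S`-morphism `u : Z ⟶ X`. -/
def WeakExtensionProperty {X S : Scheme.{u}} [IsIntegral S] (f : X ⟶ S) : Prop :=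
  ∀ (Z : Scheme.{u}) (g : Z ⟶ S), Smooth g →
    ∀ uK : genericFiber g ⟶ genericFiber f,
      uK ≫ genericFiberToSpec f = genericFiberToSpec g →
      ∃ u : Z ⟶ X, u ≫ f = g ∧ genericFiberι g ≫ u = uK ≫ genericFiberι f

/-- `f : X ⟶ S` satisfies the weak extension property universally: it satisfies the weak extension
property, and so does its base change `X ×_S S' ⟶ S'` along every morphism of finite type
`g : S' ⟶ S` (locally of finite type and quasi-compact) from a Dedekind scheme `S'`. -/
def UniversalWeakExtensionProperty {X S : Scheme.{u}} [IsIntegral S] (f : X ⟶ S) : Prop :=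
  WeakExtensionProperty f ∧
    ∀ (S' : Scheme.{u}) [IsDedekindScheme S'] (g : S' ⟶ S),
      LocallyOfFiniteType g → QuasiCompact g → WeakExtensionProperty (pullback.snd f g)

attribute [local instance] MvPolynomial.gradedAlgebra

/-- The projective line over `k`, as `Proj k[T₀, T₁]`. -/
noncomputable def projectiveLine (k : Type u) [Field k] : Scheme.{u} :=
  Proj (MvPolynomial.homogeneousSubmodule (Fin 2) k)

/-- The structure morphism of the projective line over `k`. -/
noncomputable def projectiveLineToSpec (k : Type u) [Field k] :
    projectiveLine k ⟶ Spec (CommRingCat.of k) :=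
  Proj.toSpecZero (MvPolynomial.homogeneousSubmodule (Fin 2) k) ≫
    Spec.map (CommRingCat.ofHom
      (algebraMap k (MvPolynomial.homogeneousSubmodule (Fin 2) k 0)))

/-- A scheme `p : V ⟶ Spec k` over an algebraically closed field `k` contains a rational curve:
some locally closed subscheme of `V` is isomorphic over `k` to a dense open subscheme of `ℙ¹_k`,
i.e. some dense open subscheme of `ℙ¹_k` admits an immersion into `V` over `k`. -/
def ContainsRationalCurve (k : Type u) [Field k] [IsAlgClosed k] {V : Scheme.{u}}
    (p : V ⟶ Spec (CommRingCat.of k)) : Prop :=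
  ∃ (U : (projectiveLine k).Opens) (i : U.toScheme ⟶ V),
    Dense (U : Set (projectiveLine k)) ∧ IsImmersion i ∧ i ≫ p = U.ι ≫ projectiveLineToSpec k

/-- The base change `X_{K̄} ⟶ Spec K̄` of a `K`-scheme `q : X ⟶ Spec K` to an algebraic closure. -/
noncomputable def geometricFiberToSpec (K : Type u) [Field K] {X : Scheme.{u}}
    (q : X ⟶ Spec (CommRingCat.of K)) :
    pullback q (Spec.map (CommRingCat.ofHom (algebraMap K (AlgebraicClosure K)))) ⟶
      Spec (CommRingCat.of (AlgebraicClosure K)) :=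
  pullback.snd q (Spec.map (CommRingCat.ofHom (algebraMap K (AlgebraicClosure K))))

end PseudoNeron

/-! A rational curve in the geometric generic fiber would degenerate to a nonconstant rational curve
in a closed fiber of `X`, and the universal weak extension property excludes such curves there.

Closed fibers. Let `k'` be finite over the residue field of a closed point of `S`. The affine line
over `k'` is a Dedekind scheme of finite type over `S`, so the weak extension property is available
over it. Applied to the line itself, it turns a `k'(T)`-point of `X` into a morphism `v` on the
whole line (`WeakExtensionProperty.exists_extension_of_ratFunc`). Applied to the plane over the line
with parameter `T`, it extends `v(t/T)` to some `V(t, T)`. Separatedness gives `V(tT, T) = v(t)`,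
and `T = 0` shows that `v` is the constant `V(0, 0)`
(`WeakExtensionProperty.exists_factor_of_affineLine`).

Degeneration. Let `E` be an algebraic closure of the function field, `w` a morphism to `X` from a
nonempty open part of the line over `E`, and `c` a point of that part. Choose a valuation ring `O`
of `E` dominating the local ring of a closed point `s` of `S`. Properness extends `w(c)` to an
`O`-point of `X`, and in an affine chart `A` around its specialization the germ of `w` at `c` is a
homomorphism `ρ : A → E(X)` whose values at `c` lie in `O`. If `ρ` is nonconstant, subtract from the
images of generators their values at `c`, move `c` to the origin and a pole of one of them to
infinity. There is a first radius at which the largest Gauss norm of these functions is one. After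
rescaling to that radius all of them reduce to rational functions over the residue field of `O`; the
reductions still vanish at the origin and one is nonzero, hence nonconstant
(`exists_gauss_crossing`, `exists_nonconstant_specialization`). The residue field of `O` is
algebraic over that of `s`, so the reduced point descends to a finite extension (`exists_descent`),
where the first half applies. Thus `w` is constant (`UniversalWeakExtensionProperty.eq_const`) and
cannot come from a monomorphism. -/

namespace PseudoNeron

open Polynomial

/-! ### Gauss norms of polynomials as the radius varies. -/

section GaussCrossing

variable {E Γ₀ : Type*} [Field E] [IsAlgClosed E] [LinearOrderedCommGroupWithZero Γ₀]

/-- The radii at which the monomial `α * X ^ k` dominates `Q` have a least element, and there `Q`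
has a dominating monomial of degree less than `k`. -/
lemma exists_least_dominating (v : Valuation E Γ₀) (Q : E[X]) (hQ : Q.coeff 0 ≠ 0) {k : ℕ}
    (hk : 0 < k) {α : E} (hα : α ≠ 0) {c₁ : E}
    (h₁ : ∀ l, v (Q.coeff l * c₁ ^ l) ≤ v (α * c₁ ^ k)) :
    ∃ c ≠ 0, (∀ l, v (Q.coeff l * c ^ l) ≤ v (α * c ^ k)) ∧
      (∃ l < k, v (Q.coeff l * c ^ l) = v (α * c ^ k)) ∧
      ∀ c', (∀ l, v (Q.coeff l * c' ^ l) ≤ v (α * c' ^ k)) → v c ≤ v c' := by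
  -- `v (r l)` is the radius at which the monomials of degrees `l` and `k` balance. For `l < k`,
  -- domination means `v c ≥ v (r l)`, so the least radius is the largest `v (r l)`.
  have hroot : ∀ l, ∃ r : E, l < k → α * r ^ (k - l) = Q.coeff l := by
    intro l
    by_cases hl : l < k
    · obtain ⟨r, hr⟩ := IsAlgClosed.exists_pow_nat_eq (Q.coeff l / α) (n := k - l) (by omega)
      exact ⟨r, fun _ ↦ by rw [hr]; field_simp⟩
    · exact ⟨0, fun h ↦ absurd h hl⟩
  choose r hr using hroot
  obtain ⟨l₀, hl₀, hmax⟩ := Finset.exists_max_image (Finset.range k) (fun l ↦ v (r l))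
    ⟨0, by simpa using hk⟩
  simp only [Finset.mem_range] at hl₀ hmax
  have hr0 : r 0 ≠ 0 := by
    intro h
    have := hr 0 hk
    rw [h, Nat.sub_zero, zero_pow hk.ne', mul_zero] at this
    exact hQ this.symm
  have hc0 : r l₀ ≠ 0 := by
    intro h
    have := hmax 0 hk
    rw [h, map_zero, le_zero_iff, map_eq_zero] at this
    exact hr0 this
  have hsplit : ∀ (l : ℕ) (x : E), l < k → x ^ k = x ^ (k - l) * x ^ l := by
    intro l x hl
    rw [← pow_add]
    congr 1
    omega
  have key : ∀ c', (∀ l, v (Q.coeff l * c' ^ l) ≤ v (α * c' ^ k)) → v (r l₀) ≤ v c' := by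
    intro c' h'
    have hc' : c' ≠ 0 := by
      rintro rfl
      have := h' 0
      rw [zero_pow hk.ne', mul_zero, map_zero, pow_zero, mul_one, le_zero_iff, map_eq_zero] at this
      exact hQ this
    have := h' l₀
    rw [← hr l₀ hl₀, hsplit l₀ c' hl₀, ← mul_assoc, map_mul, map_mul v (α * _),
      mul_le_mul_iff_left₀ (by simpa [zero_lt_iff] using fun h ↦ absurd h hc'), map_mul, map_mul,
      mul_le_mul_iff_right₀ (by simpa [zero_lt_iff] using hα), map_pow, map_pow] at this
    exact (pow_le_pow_iff_left₀ zero_le zero_le (by omega)).1 this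
  refine ⟨r l₀, hc0, fun l ↦ ?_, ⟨l₀, hl₀, ?_⟩, key⟩
  · rcases lt_or_ge l k with hl | hl
    · rw [← hr l hl, hsplit l (r l₀) hl, ← mul_assoc, map_mul, map_mul v (α * _), map_mul, map_mul,
        map_pow v (r l), map_pow v (r l₀) (k - l)]
      gcongr
      exact hmax l hl
    · have hc₁ : v (r l₀) ≤ v c₁ := key c₁ h₁
      have hc₁0 : c₁ ≠ 0 := by
        rintro rfl
        rw [map_zero, le_zero_iff, map_eq_zero] at hc₁
        exact hc0 hc₁
      have := h₁ l
      obtain ⟨m, rfl⟩ := Nat.exists_eq_add_of_le hl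
      have h2 : v (Q.coeff (k + m)) * v c₁ ^ m ≤ v α := by
        rw [pow_add, map_mul, map_mul, map_pow, map_pow, map_mul, map_pow, mul_comm (v c₁ ^ k),
          ← mul_assoc, mul_le_mul_iff_left₀] at this
        · exact this
        · exact pow_pos (by simpa [zero_lt_iff] using hc₁0) _
      calc v (Q.coeff (k + m) * r l₀ ^ (k + m))
          = v (Q.coeff (k + m)) * v (r l₀) ^ m * v (r l₀) ^ k := by
            rw [pow_add, map_mul, map_mul, map_pow, map_pow, mul_assoc, mul_comm (v (r l₀) ^ k)]
        _ ≤ v (Q.coeff (k + m)) * v c₁ ^ m * v (r l₀) ^ k := by gcongr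
        _ ≤ v α * v (r l₀) ^ k := by gcongr
        _ = _ := by rw [map_mul, map_pow]
  · rw [hsplit l₀ (r l₀) hl₀, ← mul_assoc, hr l₀ hl₀]

/-- Given fractions `P i / Q` vanishing at the origin, one of which has a pole at infinity, there is
a first radius at which one of them has Gauss norm one. At that radius, every dominating monomial of
every `P i` has larger degree than some dominating monomial of `Q`. -/
lemma exists_gauss_crossing (v : Valuation E Γ₀) {ι : Type*} [Finite ι] (P : ι → E[X]) (Q : E[X])
    (hQ : Q.coeff 0 ≠ 0) (hP : ∀ i, (P i).coeff 0 = 0)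
    (hdeg : ∃ i, Q.natDegree < (P i).natDegree) :
    ∃ c ≠ 0, ∃ d ≠ 0, (∀ i k, v ((P i).coeff k * c ^ k) ≤ v d) ∧
      (∀ l, v (Q.coeff l * c ^ l) ≤ v d) ∧
      (∃ i k, v ((P i).coeff k * c ^ k) = v d) ∧
      ∀ i k, v ((P i).coeff k * c ^ k) = v d → ∃ l < k, v (Q.coeff l * c ^ l) = v d := by
  classical
  cases nonempty_fintype ι
  let T : ι × ℕ → E → Prop := fun x c ↦
    ∀ l, v (Q.coeff l * c ^ l) ≤ v ((P x.1).coeff x.2 * c ^ x.2)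
  have hT0 : ∀ x c, T x c → 0 < x.2 ∧ (P x.1).coeff x.2 ≠ 0 := by
    intro x c h
    have h2 : (P x.1).coeff x.2 ≠ 0 := by
      intro h0
      have := h 0
      rw [h0, zero_mul, map_zero, pow_zero, mul_one, le_zero_iff, map_eq_zero] at this
      exact hQ this
    refine ⟨Nat.pos_of_ne_zero fun h0 ↦ h2 ?_, h2⟩
    rw [h0, hP]
  have hleast : ∀ x, (∃ c, T x c) → ∃ c ≠ 0, T x c ∧
      (∃ l < x.2, v (Q.coeff l * c ^ l) = v ((P x.1).coeff x.2 * c ^ x.2)) ∧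
      ∀ c', T x c' → v c ≤ v c' := fun x ⟨c, hc⟩ ↦
    exists_least_dominating v Q hQ (hT0 x c hc).1 (hT0 x c hc).2 hc
  -- At a large radius the leading monomial of a `P i` of degree greater than that of `Q` dominates.
  have hex : ∃ x c, T x c := by
    obtain ⟨i, hi⟩ := hdeg
    set k := (P i).natDegree
    have hα : (P i).coeff k ≠ 0 := by
      rw [coeff_natDegree, leadingCoeff_ne_zero]
      rintro h
      simp [k, h] at hi
    obtain ⟨l₀, -, hl₀⟩ := Finset.exists_max_image (Finset.range (k + 1))
      (fun l ↦ v (Q.coeff l / (P i).coeff k)) ⟨0, by simp⟩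
    let x := Q.coeff l₀ / (P i).coeff k
    obtain ⟨y, hy1, hyx⟩ : ∃ y : E, 1 ≤ v y ∧ v x ≤ v y := by
      rcases le_total (v x) 1 with h | h
      · exact ⟨1, by simp, by simpa using h⟩
      · exact ⟨x, h, le_rfl⟩
    have hy0 : (0 : Γ₀) < v y := lt_of_lt_of_le zero_lt_one hy1
    refine ⟨(i, k), y, fun l ↦ ?_⟩
    rcases lt_or_ge l k with hl | hl
    · obtain ⟨m, hm⟩ := Nat.exists_eq_add_of_lt hl
      have h1 : v (Q.coeff l) ≤ v ((P i).coeff k) * v y := by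
        have := (hl₀ l (by simp; omega)).trans hyx
        rwa [map_div₀, div_le_iff₀ (by simpa [zero_lt_iff] using hα), mul_comm] at this
      have h2 : v y ^ (l + 1) ≤ v y ^ k := pow_le_pow_right₀ hy1 hl
      calc v (Q.coeff l * y ^ l) = v (Q.coeff l) * v y ^ l := by simp
        _ ≤ v ((P i).coeff k) * v y * v y ^ l := by gcongr
        _ = v ((P i).coeff k) * v y ^ (l + 1) := by rw [pow_succ', mul_assoc]
        _ ≤ v ((P i).coeff k) * v y ^ k := by gcongr
        _ = _ := by simp
    · rw [coeff_eq_zero_of_natDegree_lt (lt_of_lt_of_le hi hl)]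
      simp
  let F : Finset (ι × ℕ) :=
    ((Finset.univ (α := ι)).biUnion fun i ↦ (P i).support.image fun k ↦ (i, k)).filter
      fun x ↦ ∃ c, T x c
  have hF : ∀ x, x ∈ F ↔ ∃ c, T x c := by
    intro x
    simp only [F, Finset.mem_filter, Finset.mem_biUnion, Finset.mem_univ, true_and,
      Finset.mem_image, mem_support_iff, and_iff_right_iff_imp]
    rintro ⟨c, hc⟩
    exact ⟨x.1, x.2, (hT0 x c hc).2, rfl⟩
  have hρ : ∀ x, ∃ c, x ∈ F → (c ≠ 0 ∧ T x c ∧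
      (∃ l < x.2, v (Q.coeff l * c ^ l) = v ((P x.1).coeff x.2 * c ^ x.2)) ∧
      ∀ c', T x c' → v c ≤ v c') := by
    intro x
    by_cases hx : x ∈ F
    · obtain ⟨c, h⟩ := hleast x ((hF x).1 hx)
      exact ⟨c, fun _ ↦ h⟩
    · exact ⟨0, fun h ↦ absurd h hx⟩
  choose ρ hρ using hρ
  -- The first crossing radius: the smallest of the finitely many least radii of domination.
  obtain ⟨x, hxF, hx⟩ := Finset.exists_min_image F (fun x ↦ v (ρ x))
    (by obtain ⟨x, hx⟩ := hex; exact ⟨x, (hF x).2 hx⟩)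
  obtain ⟨hc0, hTx, ⟨l₀, hl₀k, hl₀⟩, hmin⟩ := hρ x hxF
  set c := ρ x
  -- at radius `c`, a monomial of some `P i` dominating `Q` is equal in size to a monomial of `Q`
  have hcross : ∀ y, T y c → ∃ l < y.2,
      v (Q.coeff l * c ^ l) = v ((P y.1).coeff y.2 * c ^ y.2) := by
    intro y hy
    have hyF : y ∈ F := (hF y).2 ⟨c, hy⟩
    obtain ⟨-, -, ⟨l, hlk, hl⟩, hmin'⟩ := hρ y hyF
    have hv : v (ρ y) = v c := le_antisymm (hmin' c hy) (hx y hyF)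
    refine ⟨l, hlk, ?_⟩
    simpa [map_mul, map_pow, hv] using hl
  have hd0 : (P x.1).coeff x.2 * c ^ x.2 ≠ 0 :=
    mul_ne_zero (hT0 x c hTx).2 (pow_ne_zero _ hc0)
  refine ⟨c, hc0, _, hd0, fun i k ↦ ?_, hTx, ⟨x.1, x.2, rfl⟩, fun i k hik ↦ ?_⟩
  -- A monomial larger than `v d` would dominate `Q`, hence by `hcross` equal a monomial of `Q`; but
  -- those are at most `v d`.
  · by_contra! hlt
    obtain ⟨l, -, hl⟩ := hcross (i, k) fun l ↦ (hTx l).trans hlt.le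
    exact absurd (hTx l) (by rw [hl]; exact not_le.2 hlt)
  · obtain ⟨l, hl, h⟩ := hcross (i, k) fun l ↦ by simpa only [hik] using hTx l
    exact ⟨l, hl, h.trans hik⟩

end GaussCrossing

/-! ### Homomorphisms obtained from functional relations. -/

section FunctionalSubring

/-- A subring of a product which is the graph of a partial function yields a ring homomorphism on
everything that maps into its domain. -/
lemma exists_ringHom_of_functional {A M N : Type*} [CommRing A] [CommRing M] [CommRing N]
    (ρ : A →+* M) (G : Subring (M × N)) (h₀ : ∀ y, ((0 : M), y) ∈ G → y = 0)
    (hG : ∀ x, ∃ y, (ρ x, y) ∈ G) : ∃ ψ : A →+* N, ∀ x, (ρ x, ψ x) ∈ G := by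
  choose f hf using hG
  have huniq : ∀ x y z, ((x : M), y) ∈ G → (x, z) ∈ G → y = z := fun x y z hy hz ↦
    sub_eq_zero.1 (h₀ _ (by simpa using G.sub_mem hy hz))
  refine ⟨⟨⟨⟨f, ?_⟩, fun x y ↦ ?_⟩, ?_, fun x y ↦ ?_⟩, hf⟩
  · exact huniq 1 _ _ (by simpa using hf 1) G.one_mem
  · exact huniq (ρ x * ρ y) _ _ (by simpa using hf (x * y)) (G.mul_mem (hf x) (hf y))
  · exact huniq 0 _ _ (by simpa using hf 0) G.zero_mem
  · exact huniq (ρ x + ρ y) _ _ (by simpa using hf (x + y)) (G.add_mem (hf x) (hf y))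

end FunctionalSubring

/-! ### Reduction of rational functions along coefficient maps, and descent. -/

section Reduction

variable {R k₁ k₂ : Type*} [CommRing R] [Field k₁] [Field k₂]

/-- The fractions over `R` with denominator not killed by `w`, viewed as pairs consisting of their
images under `u` and under `w`. -/
def reductionRelation (u : R →+* k₁) (w : R →+* k₂) :
    Subring (RatFunc k₁ × RatFunc k₂) where
  carrier := {x | ∃ p q : R[X], q.map w ≠ 0 ∧
    x.1 * algebraMap k₁[X] _ (q.map u) = algebraMap k₁[X] _ (p.map u) ∧
    x.2 * algebraMap k₂[X] _ (q.map w) = algebraMap k₂[X] _ (p.map w)}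
  mul_mem' := by
    rintro ⟨x, x'⟩ ⟨y, y'⟩ ⟨p, q, hq, h₁, h₂⟩ ⟨p', q', hq', h₁', h₂'⟩
    refine ⟨p * p', q * q', by simpa using ⟨hq, hq'⟩, ?_, ?_⟩
    · simp only [Polynomial.map_mul, map_mul, Prod.fst_mul] at *
      rw [← h₁, ← h₁']; ring
    · simp only [Polynomial.map_mul, map_mul, Prod.snd_mul] at *
      rw [← h₂, ← h₂']; ring
  one_mem' := ⟨1, 1, by simp, by simp, by simp⟩
  add_mem' := by
    rintro ⟨x, x'⟩ ⟨y, y'⟩ ⟨p, q, hq, h₁, h₂⟩ ⟨p', q', hq', h₁', h₂'⟩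
    refine ⟨p * q' + p' * q, q * q', by simpa using ⟨hq, hq'⟩, ?_, ?_⟩
    · simp only [Polynomial.map_mul, Polynomial.map_add, map_mul, map_add, Prod.fst_add] at *
      rw [← h₁, ← h₁']; ring
    · simp only [Polynomial.map_mul, Polynomial.map_add, map_mul, map_add, Prod.snd_add] at *
      rw [← h₂, ← h₂']; ring
  zero_mem' := ⟨0, 1, by simp, by simp, by simp⟩
  neg_mem' := by
    rintro ⟨x, x'⟩ ⟨p, q, hq, h₁, h₂⟩
    refine ⟨-p, q, hq, ?_, ?_⟩
    · simp only [Polynomial.map_neg, map_neg, Prod.fst_neg] at *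
      rw [← h₁]; ring
    · simp only [Polynomial.map_neg, map_neg, Prod.snd_neg] at *
      rw [← h₂]; ring

variable {u : R →+* k₁} {w : R →+* k₂}

/-- A vanishing first coordinate forces the numerator to vanish already over `R`, because `u` is
injective. This makes the relation the graph of a partial function, as
`exists_ringHom_of_functional` requires. -/
lemma eq_zero_of_zero_mem_reductionRelation (hu : Function.Injective u) {y : RatFunc k₂}
    (h : (0, y) ∈ reductionRelation u w) : y = 0 := by
  obtain ⟨p, q, hq, h₁, h₂⟩ := h
  have hp : p = 0 := by
    have : p.map u = 0 := by
      apply RatFunc.algebraMap_injective k₁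
      rw [map_zero, ← h₁, zero_mul]
    exact (Polynomial.map_eq_zero_iff hu).1 this
  rw [hp, Polynomial.map_zero, map_zero] at h₂
  exact (mul_eq_zero.1 h₂).resolve_right (RatFunc.algebraMap_ne_zero hq)

lemma C_mem_reductionRelation (r : R) :
    (RatFunc.C (u r), RatFunc.C (w r)) ∈ reductionRelation u w :=
  ⟨C r, 1, by simp, by simp, by simp⟩

lemma mem_reductionRelation_of_mul_eq {x : RatFunc k₁} {p q : R[X]} (hq : q.map w ≠ 0)
    (h : x * algebraMap k₁[X] _ (q.map u) = algebraMap k₁[X] _ (p.map u)) :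
    (x, algebraMap k₂[X] (RatFunc k₂) (p.map w) / algebraMap k₂[X] _ (q.map w)) ∈
      reductionRelation u w :=
  ⟨p, q, hq, h, div_mul_cancel₀ _ (RatFunc.algebraMap_ne_zero hq)⟩

variable {A B : Type*} [CommRing A] [CommRing B] [Algebra B A]

/-- A homomorphism to `k₁(X)` from an algebra of finite type can be reduced to `k₂(X)` as soon as
the images of generators can. -/
lemma exists_reduction (hu : Function.Injective u) (ρ : A →+* RatFunc k₁) (β : B →+* R)
    (hρ : ∀ b, ρ (algebraMap B A b) = RatFunc.C (u (β b))) {s : Set A}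
    (hs : Algebra.adjoin B s = ⊤) (h : ∀ x ∈ s, ∃ y, (ρ x, y) ∈ reductionRelation u w) :
    ∃ ψ : A →+* RatFunc k₂, ∀ x, (ρ x, ψ x) ∈ reductionRelation u w := by
  refine exists_ringHom_of_functional ρ _ (fun y ↦ eq_zero_of_zero_mem_reductionRelation hu)
    fun x ↦ ?_
  have hx : x ∈ Algebra.adjoin B s := hs ▸ Algebra.mem_top
  induction hx using Algebra.adjoin_induction with
  | mem x hx => exact h x hx
  | algebraMap b => exact ⟨_, (hρ b).symm ▸ C_mem_reductionRelation (w := w) (β b)⟩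
  | add x y _ _ hx hy =>
    obtain ⟨⟨x', hx⟩, ⟨y', hy⟩⟩ := And.intro hx hy
    exact ⟨x' + y', by simpa using Subring.add_mem _ hx hy⟩
  | mul x y _ _ hx hy =>
    obtain ⟨⟨x', hx⟩, ⟨y', hy⟩⟩ := And.intro hx hy
    exact ⟨x' * y', by simpa using Subring.mul_mem _ hx hy⟩

lemma eq_of_mem_reductionRelation (hu : Function.Injective u) {x : RatFunc k₁} {y z : RatFunc k₂}
    (hy : (x, y) ∈ reductionRelation u w) (hz : (x, z) ∈ reductionRelation u w) : y = z :=
  sub_eq_zero.1 <| eq_zero_of_zero_mem_reductionRelation hu (w := w)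
    (by simpa using Subring.sub_mem _ hy hz)

/-- If the images of all generators of an algebra are constants, so are all images. -/
lemma exists_generator_nonconstant (ρ : A →+* RatFunc k₁) (β : B →+* k₁)
    (hρ : ∀ b, ρ (algebraMap B A b) = RatFunc.C (β b)) {s : Set A}
    (hs : Algebra.adjoin B s = ⊤) (h : ∃ x, ∀ e, ρ x ≠ RatFunc.C e) :
    ∃ x ∈ s, ∀ e, ρ x ≠ RatFunc.C e := by
  by_contra! hcon
  obtain ⟨x, hx'⟩ := h
  suffices ∃ e, ρ x = RatFunc.C e from hx' _ this.choose_spec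
  have hx : x ∈ Algebra.adjoin B s := hs ▸ Algebra.mem_top
  clear hx'
  induction hx using Algebra.adjoin_induction with
  | mem x hx => exact hcon x hx
  | algebraMap b => exact ⟨_, hρ b⟩
  | add x y _ _ hx hy =>
    obtain ⟨⟨x', hx⟩, ⟨y', hy⟩⟩ := And.intro hx hy
    exact ⟨x' + y', by simp [hx, hy]⟩
  | mul x y _ _ hx hy =>
    obtain ⟨⟨x', hx⟩, ⟨y', hy⟩⟩ := And.intro hx hy
    exact ⟨x' * y', by simp [hx, hy]⟩

/-- A homomorphism from an algebra of finite type to `k(X)`, where `k` is algebraic over `k₀`, is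
defined over a finite extension of `k₀`. -/
lemma exists_descent {k₀ k : Type*} [Field k₀] [Field k] [Algebra k₀ k] [Algebra.IsAlgebraic k₀ k]
    [Algebra.FiniteType B A] (ψ : A →+* RatFunc k) (β : B →+* k₀)
    (hψ : ∀ b, ψ (algebraMap B A b) = RatFunc.C (algebraMap k₀ k (β b)))
    (hnc : ∃ x, ∀ e, ψ x ≠ RatFunc.C e) :
    ∃ (k' : IntermediateField k₀ k) (_ : FiniteDimensional k₀ k') (ψ' : A →+* RatFunc k'),
      (∀ b, ψ' (algebraMap B A b) = RatFunc.C (algebraMap k₀ k' (β b))) ∧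
      ∃ x, ∀ e, ψ' x ≠ RatFunc.C e := by
  classical
  obtain ⟨s, hs⟩ := Algebra.FiniteType.out (R := B) (A := A)
  -- The coefficients of the images of finitely many generators suffice to define the whole
  -- homomorphism.
  let T : Finset k := s.biUnion fun x ↦ (ψ x).num.coeffs ∪ (ψ x).denom.coeffs
  let k' := IntermediateField.adjoin k₀ (T : Set k)
  have hfin : FiniteDimensional k₀ k' :=
    IntermediateField.finiteDimensional_adjoin fun x _ ↦ Algebra.IsIntegral.isIntegral x
  have hu : Function.Injective (algebraMap k' k) := (algebraMap k' k).injective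
  have hlift : ∀ p : k[X], (↑p.coeffs : Set k) ⊆ T → ∃ p' : k'[X], p'.map (algebraMap k' k) = p := by
    intro p hp
    rw [← Polynomial.mem_lifts, Polynomial.lifts_iff_coeffs_subset_range]
    intro x hx
    exact ⟨⟨x, IntermediateField.subset_adjoin _ _ (hp hx)⟩, rfl⟩
  -- With the identity of `k'` as second map, the relation identifies elements of `k(X)` that come
  -- from `k'(X)` with their preimages.
  have h : ∀ x ∈ (s : Set A), ∃ y, (ψ x, y) ∈
      reductionRelation (algebraMap k' k) (RingHom.id k') := by
    intro x hx
    obtain ⟨p, hp⟩ := hlift (ψ x).num fun y hy ↦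
      Finset.mem_biUnion.2 ⟨x, hx, Finset.mem_union_left _ hy⟩
    obtain ⟨q, hq⟩ := hlift (ψ x).denom fun y hy ↦
      Finset.mem_biUnion.2 ⟨x, hx, Finset.mem_union_right _ hy⟩
    refine ⟨_, mem_reductionRelation_of_mul_eq (p := p) (q := q) ?_ ?_⟩
    · rw [Polynomial.map_id]
      rintro rfl
      exact (ψ x).denom_ne_zero (by rw [← hq, Polynomial.map_zero])
    · rw [hp, hq]
      nth_rw 1 [← RatFunc.num_div_denom (ψ x)]
      exact div_mul_cancel₀ _ (RatFunc.algebraMap_ne_zero (ψ x).denom_ne_zero)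
  obtain ⟨ψ', hψ'⟩ := exists_reduction hu ψ ((algebraMap k₀ k').comp β) hψ hs h
  refine ⟨k', hfin, ψ', fun b ↦ ?_, ?_⟩
  · refine eq_of_mem_reductionRelation hu (hψ' _) ?_
    rw [hψ b]
    exact C_mem_reductionRelation (algebraMap k₀ k' (β b))
  · obtain ⟨x, hx⟩ := hnc
    refine ⟨x, fun e he ↦ hx (algebraMap k' k e) ?_⟩
    obtain ⟨p, q, hq, h₁, h₂⟩ := he ▸ hψ' x
    have hpq : p = C e * q := by
      apply RatFunc.algebraMap_injective k'
      simpa using h₂.symm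
    rw [hpq] at h₁
    have hq' : q.map (algebraMap k' k) ≠ 0 := by
      rw [Polynomial.map_id] at hq
      exact (Polynomial.map_ne_zero_iff hu).2 hq
    exact mul_right_cancel₀ (RatFunc.algebraMap_ne_zero hq') (by simpa using h₁)

end Reduction

/-! ### Values of rational functions and changes of coordinate on the projective line. -/

section Substitution

variable {E : Type*} [Field E]

/-- The rational functions regular at `a`, together with their values. -/
def evaluationRelation (a : E) : Subring (RatFunc E × E) where
  carrier := {x | ∃ p q : E[X], q.eval a ≠ 0 ∧
    x.1 * algebraMap E[X] _ q = algebraMap E[X] _ p ∧ x.2 * q.eval a = p.eval a}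
  mul_mem' := by
    rintro ⟨x, x'⟩ ⟨y, y'⟩ ⟨p, q, hq, h₁, h₂⟩ ⟨p', q', hq', h₁', h₂'⟩
    refine ⟨p * p', q * q', by simpa using ⟨hq, hq'⟩, ?_, ?_⟩
    · simp only [map_mul, Prod.fst_mul] at *
      rw [← h₁, ← h₁']; ring
    · simp only [eval_mul, Prod.snd_mul] at *
      rw [← h₂, ← h₂']; ring
  one_mem' := ⟨1, 1, by simp, by simp, by simp⟩
  add_mem' := by
    rintro ⟨x, x'⟩ ⟨y, y'⟩ ⟨p, q, hq, h₁, h₂⟩ ⟨p', q', hq', h₁', h₂'⟩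
    refine ⟨p * q' + p' * q, q * q', by simpa using ⟨hq, hq'⟩, ?_, ?_⟩
    · simp only [map_mul, map_add, Prod.fst_add] at *
      rw [← h₁, ← h₁']; ring
    · simp only [eval_mul, eval_add, Prod.snd_add] at *
      rw [← h₂, ← h₂']; ring
  zero_mem' := ⟨0, 1, by simp, by simp, by simp⟩
  neg_mem' := by
    rintro ⟨x, x'⟩ ⟨p, q, hq, h₁, h₂⟩
    refine ⟨-p, q, hq, ?_, ?_⟩
    · simp only [map_neg, Prod.fst_neg] at *
      rw [← h₁]; ring
    · simp only [eval_neg, Prod.snd_neg] at *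
      rw [← h₂]; ring

lemma mem_evaluationRelation {a : E} {x : RatFunc E × E} : x ∈ evaluationRelation a ↔
    ∃ p q : E[X], q.eval a ≠ 0 ∧
      x.1 * algebraMap E[X] _ q = algebraMap E[X] _ p ∧ x.2 * q.eval a = p.eval a := Iff.rfl

lemma C_mem_evaluationRelation (a e : E) : (RatFunc.C e, e) ∈ evaluationRelation a :=
  ⟨C e, 1, by simp, by simp, by simp⟩

lemma inv_mem_evaluationRelation {a : E} {x : RatFunc E} {e : E} (he : e ≠ 0)
    (h : (x, e) ∈ evaluationRelation a) : (x⁻¹, e⁻¹) ∈ evaluationRelation a := by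
  obtain ⟨p, q, hq, h₁, h₂⟩ := h
  dsimp only at h₁ h₂
  have hp : p.eval a ≠ 0 := h₂ ▸ mul_ne_zero he hq
  have hx : x ≠ 0 := by
    rintro rfl
    rw [zero_mul] at h₁
    have : p = 0 := RatFunc.algebraMap_injective E (by rw [← h₁, map_zero])
    simp [this] at hp
  refine ⟨q, p, hp, ?_, ?_⟩
  · rw [← h₁, inv_mul_cancel_left₀ hx]
  · rw [← h₂, inv_mul_cancel_left₀ he]

lemma aeval_mem_evaluationRelation {a b : E} {τ : RatFunc E}
    (h : (τ, a) ∈ evaluationRelation b) (p : E[X]) :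
    (aeval τ p, p.eval a) ∈ evaluationRelation b := by
  induction p using Polynomial.induction_on' with
  | add p q hp hq => simpa using Subring.add_mem _ hp hq
  | monomial n e =>
    have := Subring.mul_mem _ (C_mem_evaluationRelation b e) (Subring.pow_mem _ h n)
    simpa [aeval_monomial, RatFunc.algebraMap_eq_C] using this

lemma aeval_algebraMap_eq_comp (p q : E[X]) :
    aeval (algebraMap E[X] (RatFunc E) q) p = algebraMap E[X] _ (p.comp q) := by
  rw [aeval_algebraMap_apply]
  rfl

/-- The substitution `X ↦ τ` for a nonconstant rational function `τ`. -/
lemma exists_substitution (τ : RatFunc E) (hτ : ¬ ∃ e, τ = RatFunc.C e) :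
    ∃ θ : RatFunc E →+* RatFunc E, ∀ p : E[X], θ (algebraMap E[X] _ p) = aeval τ p := by
  have hinj := transcendental_iff_injective.1 (RatFunc.transcendental_of_ne_C τ hτ)
  refine ⟨RatFunc.liftRingHom (aeval τ).toRingHom
    (nonZeroDivisors_le_comap_nonZeroDivisors_of_injective _ hinj), fun p ↦ ?_⟩
  rw [RatFunc.liftRingHom_algebraMap]
  rfl

/-- If `p / q` has `q(a) ≠ 0` and `τ(b) = a`, then the denominator `q(τ)` takes the value `q(a) ≠ 0`
at `b`. -/
lemma map_mem_evaluationRelation {a b : E} {τ : RatFunc E} {θ : RatFunc E →+* RatFunc E}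
    (hθ : ∀ p : E[X], θ (algebraMap E[X] _ p) = aeval τ p)
    (h : (τ, a) ∈ evaluationRelation b) {x : RatFunc E} {e : E}
    (hx : (x, e) ∈ evaluationRelation a) : (θ x, e) ∈ evaluationRelation b := by
  obtain ⟨p, q, hq, h₁, h₂⟩ := hx
  dsimp only at h₁ h₂
  have hp' := aeval_mem_evaluationRelation h p
  have hq' := aeval_mem_evaluationRelation h q
  rw [← hθ] at hp' hq'
  have hq0 : q ≠ 0 := by rintro rfl; simp at hq
  have := Subring.mul_mem _ hp' (inv_mem_evaluationRelation hq hq')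
  convert this using 1
  refine Prod.ext ?_ ?_
  · simp only [Prod.fst_mul]
    rw [← h₁, map_mul, mul_assoc, mul_inv_cancel₀, mul_one]
    exact (map_ne_zero θ).2 (RatFunc.algebraMap_ne_zero hq0)
  · simp only [Prod.snd_mul]
    rw [← h₂, mul_assoc, mul_inv_cancel₀ hq, mul_one]

lemma map_C_of_substitution {τ : RatFunc E} {θ : RatFunc E →+* RatFunc E}
    (hθ : ∀ p : E[X], θ (algebraMap E[X] _ p) = aeval τ p) (e : E) :
    θ (RatFunc.C e) = RatFunc.C e := by
  rw [← RatFunc.algebraMap_C, hθ, aeval_C, RatFunc.algebraMap_eq_C]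
  simp

/-- The hypotheses say that `τ` takes the value `b` at infinity, to first order. Splitting `p` into
linear factors, only those at the root `b` contribute, so poles at `b` become poles at infinity. -/
lemma intDegree_substitution_of_ne_zero [IsAlgClosed E] {τ : RatFunc E} {b : E}
    (hτ : ∀ e, τ - RatFunc.C e ≠ 0)
    (hdeg : ∀ e, e ≠ b → (τ - RatFunc.C e).intDegree = 0) (hb : (τ - RatFunc.C b).intDegree = -1)
    {p : E[X]} (hp : p ≠ 0) :
    aeval τ p ≠ 0 ∧ (aeval τ p).intDegree = - (p.rootMultiplicity b : ℤ) := by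
  classical
  have hprod : ∀ s : Multiset E, (s.map fun e ↦ τ - RatFunc.C e).prod ≠ 0 ∧
      ((s.map fun e ↦ τ - RatFunc.C e).prod).intDegree = - (s.count b : ℤ) := by
    intro s
    induction s using Multiset.induction with
    | empty => simp
    | cons e s ih =>
      rw [Multiset.map_cons, Multiset.prod_cons]
      refine ⟨mul_ne_zero (hτ e) ih.1, ?_⟩
      rw [RatFunc.intDegree_mul (hτ e) ih.1, ih.2]
      by_cases h : e = b
      · subst h; rw [hb]; simp
      · rw [hdeg e h, Multiset.count_cons_of_ne (Ne.symm h)]; simp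
  have heq : aeval τ p = RatFunc.C p.leadingCoeff *
      (p.roots.map fun e ↦ τ - RatFunc.C e).prod := by
    conv_lhs => rw [(IsAlgClosed.splits p).eq_prod_roots]
    rw [map_mul, map_multiset_prod, Multiset.map_map, aeval_C, RatFunc.algebraMap_eq_C]
    simp [RatFunc.algebraMap_eq_C]
  have hC : (RatFunc.C p.leadingCoeff : RatFunc E) ≠ 0 := by simpa using hp
  rw [heq]
  refine ⟨mul_ne_zero hC (hprod _).1, ?_⟩
  rw [RatFunc.intDegree_mul hC (hprod _).1, RatFunc.intDegree_C, (hprod _).2, count_roots, zero_add]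

lemma intDegree_linear_div {c₀ c₁ : E} (h : c₁ ≠ 0) :
    algebraMap E[X] (RatFunc E) (C c₀ + C c₁ * X) ≠ 0 ∧
    (algebraMap E[X] (RatFunc E) (C c₀ + C c₁ * X)).intDegree = 1 := by
  have : (C c₀ + C c₁ * X : E[X]).natDegree = 1 := by
    rw [add_comm]; exact natDegree_linear h
  refine ⟨RatFunc.algebraMap_ne_zero fun h0 ↦ by simp [h0] at this, ?_⟩
  rw [RatFunc.intDegree_polynomial, this]
  rfl

/-- A nonconstant rational function regular at `a` can be brought, by a change of coordinate on the
projective line, into a form where `a` is the origin and there is a pole at infinity. -/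
lemma exists_coordinate [IsAlgClosed E] {a e₀ : E} {f : RatFunc E}
    (hf : ¬ ∃ e, f = RatFunc.C e) (hfa : (f, e₀) ∈ evaluationRelation a) :
    ∃ θ : RatFunc E →+* RatFunc E, (∀ e, θ (RatFunc.C e) = RatFunc.C e) ∧
      (∀ x e, (x, e) ∈ evaluationRelation a → (θ x, e) ∈ evaluationRelation 0) ∧
      0 < (θ f).intDegree := by
  have hden : algebraMap E[X] (RatFunc E) f.denom ≠ 0 :=
    RatFunc.algebraMap_ne_zero f.denom_ne_zero
  have hnum0 : f.num ≠ 0 := by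
    intro h
    refine hf ⟨0, ?_⟩
    rw [map_zero, RatFunc.num_eq_zero_iff.1 h]
  -- If `f` already has a pole at infinity, a translation is enough. Otherwise its denominator is
  -- nonconstant and `f` has a pole at a finite point `b`.
  by_cases hlt : f.denom.natDegree < f.num.natDegree
  · have hτ : ¬ ∃ e, (RatFunc.X + RatFunc.C a : RatFunc E) = RatFunc.C e := by
      rintro ⟨e, he⟩
      have : (X : E[X]) = C (e - a) := RatFunc.algebraMap_injective E (by
        rw [RatFunc.algebraMap_X, RatFunc.algebraMap_C, map_sub, ← he, add_sub_cancel_right])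
      simpa using congrArg natDegree this
    obtain ⟨θ, hθ⟩ := exists_substitution _ hτ
    have hcomp : ∀ p : E[X], θ (algebraMap E[X] _ p) = algebraMap E[X] _ (p.comp (X + C a)) := by
      intro p
      rw [← aeval_algebraMap_eq_comp, hθ, map_add, RatFunc.algebraMap_X, RatFunc.algebraMap_C]
    refine ⟨θ, map_C_of_substitution hθ, fun x e h ↦ map_mem_evaluationRelation hθ ?_ h, ?_⟩
    · exact ⟨X + C a, 1, by simp, by simp, by simp⟩
    · rw [← RatFunc.num_div_denom f, map_div₀, hcomp, hcomp, RatFunc.intDegree_div,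
        RatFunc.intDegree_polynomial, RatFunc.intDegree_polynomial, natDegree_comp, natDegree_comp]
      · simpa using hlt
      all_goals
        rw [← hcomp]
        exact (map_ne_zero θ).2 (RatFunc.algebraMap_ne_zero (by simp [hnum0, f.denom_ne_zero]))
  · have hdeg : f.denom.natDegree ≠ 0 := by
      intro h
      have h' : f.num.natDegree = 0 := by omega
      rw [natDegree_eq_zero] at h h'
      obtain ⟨⟨u, hu⟩, ⟨w, hw⟩⟩ := And.intro h h'
      refine hf ⟨w / u, ?_⟩
      rw [← RatFunc.num_div_denom f, ← hu, ← hw]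
      simp
    obtain ⟨b, hb⟩ := IsAlgClosed.exists_root f.denom
      (by rw [degree_eq_natDegree f.denom_ne_zero]; exact_mod_cast hdeg)
    have hnum : ¬ f.num.IsRoot b := by
      intro h
      obtain ⟨u, w, huw⟩ := f.isCoprime_num_denom
      have := congrArg (eval b) huw
      rw [eval_add, eval_mul, eval_mul, h.eq_zero, hb.eq_zero] at this
      simp at this
    have hab : a ≠ b := by
      rintro rfl
      obtain ⟨p, q, hq, h₁, -⟩ := hfa
      have : f.num * q = p * f.denom := by
        apply RatFunc.algebraMap_injective E
        rw [map_mul, map_mul, ← h₁]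
        nth_rw 2 [← RatFunc.num_div_denom f]
        field_simp
      have := congrArg (eval a) this
      rw [eval_mul, eval_mul, hb.eq_zero, mul_zero] at this
      exact (mul_ne_zero hnum hq) this
    have hD := intDegree_linear_div (c₀ := (1 : E)) (c₁ := -1) (by simp)
    set D := algebraMap E[X] (RatFunc E) (C 1 + C (-1) * X) with hDdef
    -- The Möbius map `(a - bX) / (1 - X)` sends the origin to `a` and infinity to `b`; it is
    -- nonconstant as `a ≠ b`.
    let τ : RatFunc E := algebraMap E[X] _ (C a + C (-b) * X) / D
    have hsub : ∀ e, τ - RatFunc.C e =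
        algebraMap E[X] _ (C (a - e) + C (e - b) * X) / D := by
      intro e
      rw [eq_div_iff hD.1, sub_mul, div_mul_cancel₀ _ hD.1, hDdef, ← RatFunc.algebraMap_C,
        ← map_mul, ← map_sub]
      congr 1
      simp only [map_sub, map_neg, map_one]
      ring
    have h1 : ∀ e, e ≠ b → τ - RatFunc.C e ≠ 0 ∧ (τ - RatFunc.C e).intDegree = 0 := by
      intro e he
      have := intDegree_linear_div (c₀ := a - e) (sub_ne_zero.2 he)
      rw [hsub]
      refine ⟨div_ne_zero this.1 hD.1, ?_⟩
      rw [RatFunc.intDegree_div this.1 hD.1, this.2, hD.2, sub_self]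
    have h2 : τ - RatFunc.C b ≠ 0 ∧ (τ - RatFunc.C b).intDegree = -1 := by
      have hne : algebraMap E[X] (RatFunc E) (C (a - b)) ≠ 0 :=
        RatFunc.algebraMap_ne_zero (by simpa [sub_eq_zero] using hab)
      rw [hsub, sub_self b, map_zero, zero_mul, add_zero]
      refine ⟨div_ne_zero hne hD.1, ?_⟩
      rw [RatFunc.intDegree_div hne hD.1, hD.2, RatFunc.intDegree_polynomial]
      simp
    have h3 : ∀ e, τ - RatFunc.C e ≠ 0 := fun e ↦ by
      by_cases h : e = b
      · exact h ▸ h2.1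
      · exact (h1 e h).1
    obtain ⟨θ, hθ⟩ := exists_substitution τ fun ⟨e, he⟩ ↦ h3 e (sub_eq_zero.2 he)
    refine ⟨θ, map_C_of_substitution hθ, fun x e h ↦ map_mem_evaluationRelation hθ ?_ h, ?_⟩
    · exact ⟨_, _, by simp, div_mul_cancel₀ _ hD.1, by simp⟩
    · have hn := intDegree_substitution_of_ne_zero h3 (fun e he ↦ (h1 e he).2) h2.2 hnum0
      have hd := intDegree_substitution_of_ne_zero h3 (fun e he ↦ (h1 e he).2) h2.2 f.denom_ne_zero
      rw [← RatFunc.num_div_denom f, map_div₀, hθ, hθ, RatFunc.intDegree_div hn.1 hd.1, hn.2, hd.2,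
        rootMultiplicity_eq_zero hnum]
      have := (rootMultiplicity_pos f.denom_ne_zero).2 hb
      simpa using this

end Substitution

/-! ### Specialization of nonconstant points over a valuation ring. -/

section Specialization

variable {E : Type*} [Field E]

/-- Rescaling polynomials so that they become integral for a valuation. -/
lemma exists_integral_rescaling (O : ValuationSubring E) (p : E[X]) {c d : E} (hd : d ≠ 0)
    (h : ∀ k, O.valuation (p.coeff k * c ^ k) ≤ O.valuation d) :
    ∃ p' : O[X], p'.map (algebraMap O E) = C d⁻¹ * p.comp (C c * X) ∧
      ∀ k, (p'.map (IsLocalRing.residue O)).coeff k ≠ 0 ↔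
        O.valuation (p.coeff k * c ^ k) = O.valuation d := by
  have hmem : C d⁻¹ * p.comp (C c * X) ∈ Polynomial.lifts (algebraMap O E) := by
    rw [lifts_iff_coeff_lifts]
    intro k
    rw [coeff_C_mul, comp_C_mul_X_coeff]
    refine ⟨⟨d⁻¹ * (p.coeff k * c ^ k), (O.valuation_le_one_iff _).1 ?_⟩, rfl⟩
    rw [map_mul, map_inv₀, inv_mul_le_iff₀ (by simpa [zero_lt_iff] using hd), mul_one]
    exact h k
  obtain ⟨p', hp'⟩ := (Polynomial.mem_lifts _).1 hmem
  refine ⟨p', hp', fun k ↦ ?_⟩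
  have hk : (p'.coeff k : E) = d⁻¹ * (p.coeff k * c ^ k) := by
    have := congrArg (coeff · k) hp'
    simpa [coeff_map, comp_C_mul_X_coeff] using this
  rw [coeff_map, ne_eq, IsLocalRing.residue_eq_zero_iff, O.valuation_lt_one_iff, hk, not_lt, map_mul,
    map_inv₀, le_inv_mul_iff₀ (by simpa [zero_lt_iff] using hd), mul_one]
  exact ⟨fun h' ↦ le_antisymm (h k) h', fun h' ↦ h'.ge⟩

variable [IsAlgClosed E]

/-- A finite family of rational functions vanishing at the origin, one of which has a pole at
infinity, can be rescaled so that it reduces to a family of rational functions over the residue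
field, one of which is nonconstant. -/
lemma exists_rescaling (O : ValuationSubring E) {ι : Type*} [Finite ι] (f : ι → RatFunc E)
    (h₀ : ∀ i, (f i, 0) ∈ evaluationRelation 0) (hpole : ∃ i, 0 < (f i).intDegree) :
    ∃ (θ : RatFunc E →+* RatFunc E) (f' : ι → RatFunc (IsLocalRing.ResidueField O)),
      (∀ e, θ (RatFunc.C e) = RatFunc.C e) ∧
      (∀ i, (θ (f i), f' i) ∈ reductionRelation (algebraMap O E) (IsLocalRing.residue O)) ∧
      ∃ i, ∀ e, f' i ≠ RatFunc.C e := by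
  classical
  cases nonempty_fintype ι
  choose p q hq hpq hp using fun i ↦ mem_evaluationRelation.1 (h₀ i)
  dsimp only at hpq hp
  have hq' : ∀ i, q i ≠ 0 := fun i h ↦ by simpa [h] using hq i
  -- A common denominator, so that one radius serves all the functions.
  let Q : E[X] := ∏ i, q i
  let P : ι → E[X] := fun i ↦ p i * ∏ j ∈ Finset.univ.erase i, q j
  have hPQ : ∀ i, f i * algebraMap E[X] _ Q = algebraMap E[X] _ (P i) := by
    intro i
    rw [show Q = q i * ∏ j ∈ Finset.univ.erase i, q j from
      (Finset.mul_prod_erase _ _ (Finset.mem_univ i)).symm, map_mul, map_mul, ← hpq, mul_assoc]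
  have hQ : Q.coeff 0 ≠ 0 := by
    rw [coeff_zero_eq_eval_zero, eval_prod]
    exact Finset.prod_ne_zero_iff.2 fun i _ ↦ hq i
  have hQ0 : Q ≠ 0 := fun h ↦ by simp [h] at hQ
  have hP : ∀ i, (P i).coeff 0 = 0 := by
    intro i
    rw [coeff_zero_eq_eval_zero, eval_mul, ← hp i, zero_mul, zero_mul]
  have hdeg : ∃ i, Q.natDegree < (P i).natDegree := by
    obtain ⟨i, hi⟩ := hpole
    refine ⟨i, ?_⟩
    have hfi : f i ≠ 0 := by
      intro h
      simp [h] at hi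
    have := congrArg RatFunc.intDegree (hPQ i)
    rw [RatFunc.intDegree_mul hfi (RatFunc.algebraMap_ne_zero hQ0), RatFunc.intDegree_polynomial,
      RatFunc.intDegree_polynomial] at this
    omega
  obtain ⟨c, hc, d, hd, hPle, hQle, ⟨i₀, k₀, hik⟩, hcross⟩ :=
    exists_gauss_crossing O.valuation P Q hQ hP hdeg
  have hτ : ¬ ∃ e, algebraMap E[X] (RatFunc E) (C c * X) = RatFunc.C e := by
    rintro ⟨e, he⟩
    have h1 : (C c * X : E[X]) = C e := RatFunc.algebraMap_injective E (by
      rw [he, RatFunc.algebraMap_C])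
    have := congrArg (coeff · 1) h1
    simp [coeff_C] at this
    exact hc this
  obtain ⟨θ, hθ⟩ := exists_substitution _ hτ
  obtain ⟨Q', hQ', hQ'r⟩ := exists_integral_rescaling O Q hd hQle
  choose P' hP' hP'r using fun i ↦ exists_integral_rescaling O (P i) hd (hPle i)
  have hcontra : ∀ i k, ((P' i).map (IsLocalRing.residue O)).coeff k ≠ 0 →
      ∃ l < k, (Q'.map (IsLocalRing.residue O)).coeff l ≠ 0 := by
    intro i k hk
    obtain ⟨l, hl, h⟩ := hcross i k ((hP'r i k).1 hk)
    exact ⟨l, hl, (hQ'r l).2 h⟩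
  have hPne : (P' i₀).map (IsLocalRing.residue O) ≠ 0 := by
    intro h
    have := (hP'r i₀ k₀).2 hik
    rw [h] at this
    simp at this
  have hQne : Q'.map (IsLocalRing.residue O) ≠ 0 := by
    intro h
    obtain ⟨l, -, hl⟩ := hcontra i₀ k₀ ((hP'r i₀ k₀).2 hik)
    rw [h] at hl
    simp at hl
  refine ⟨θ, _, map_C_of_substitution hθ, fun i ↦ mem_reductionRelation_of_mul_eq
    (p := P' i) (q := Q') hQne ?_, i₀, fun e he ↦ ?_⟩
  · rw [hQ', hP', map_mul, map_mul, ← aeval_algebraMap_eq_comp, ← aeval_algebraMap_eq_comp,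
      ← hθ, ← hθ, ← hPQ i, map_mul]
    ring
  · rw [div_eq_iff (RatFunc.algebraMap_ne_zero hQne), ← RatFunc.algebraMap_C, ← map_mul] at he
    replace he := RatFunc.algebraMap_injective _ he
    have he0 : e ≠ 0 := by
      rintro rfl
      simp only [map_zero, zero_mul] at he
      exact hPne he
    -- The reduced denominator has strictly smaller order at the origin than the reduced numerator,
    -- so their ratio cannot be a nonzero constant.
    obtain ⟨k, hk, hmin⟩ : ∃ k, ((P' i₀).map (IsLocalRing.residue O)).coeff k ≠ 0 ∧
        ∀ l < k, ((P' i₀).map (IsLocalRing.residue O)).coeff l = 0 := by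
      have hex : ∃ k, ((P' i₀).map (IsLocalRing.residue O)).coeff k ≠ 0 := by
        by_contra! h
        exact hPne (Polynomial.ext (by simpa using h))
      exact ⟨Nat.find hex, Nat.find_spec hex, fun l hl ↦ not_not.1 (Nat.find_min hex hl)⟩
    obtain ⟨l, hl, hne⟩ := hcontra i₀ k hk
    have := hmin l hl
    rw [he, coeff_C_mul] at this
    exact hne ((mul_eq_zero.1 this).resolve_left he0)

/-- Let `O` be a valuation ring of an algebraically closed field `E`, and let `A` be an algebra of
finite type over `B`. A nonconstant `E(X)`-point of `A` with an `O`-valued specialization at a point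
of the line gives rise to a nonconstant `k(X)`-point of `A`, where `k` is the residue field. -/
theorem exists_nonconstant_specialization (O : ValuationSubring E) {A B : Type*} [CommRing A]
    [CommRing B] [Algebra B A] [Algebra.FiniteType B A] (β : B →+* O) (ε : A →+* O) {a : E}
    (ρ : A →+* RatFunc E) (hρ : ∀ b, ρ (algebraMap B A b) = RatFunc.C (β b : E))
    (hε : ∀ x, (ρ x, (ε x : E)) ∈ evaluationRelation a) (hnc : ∃ x, ∀ e, ρ x ≠ RatFunc.C e) :
    ∃ ψ : A →+* RatFunc (IsLocalRing.ResidueField O),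
      (∀ b, ψ (algebraMap B A b) = RatFunc.C (IsLocalRing.residue O (β b))) ∧
      ∃ x, ∀ e, ψ x ≠ RatFunc.C e := by
  obtain ⟨s, hs⟩ := Algebra.FiniteType.out (R := B) (A := A)
  obtain ⟨x₀, hx₀s, hx₀⟩ := exists_generator_nonconstant ρ (O.subtype.comp β) hρ hs hnc
  have hdiff : ∀ x, (ρ x - RatFunc.C (ε x : E), (0 : E)) ∈ evaluationRelation a := fun x ↦ by
    simpa using Subring.sub_mem _ (hε x) (C_mem_evaluationRelation a (ε x : E))
  obtain ⟨θ₁, hθ₁C, hθ₁, hpole⟩ := exists_coordinate (f := ρ x₀ - RatFunc.C (ε x₀ : E))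
    (fun ⟨e, he⟩ ↦ hx₀ (e + ε x₀) (by rw [map_add, ← he, sub_add_cancel])) (hdiff x₀)
  obtain ⟨θ₂, f', hθ₂C, hθ₂, ⟨x₁, hx₁s⟩, hx₁⟩ := exists_rescaling O
    (fun x : s ↦ θ₁ (ρ x - RatFunc.C (ε x : E))) (fun x ↦ hθ₁ _ _ (hdiff x)) ⟨⟨x₀, hx₀s⟩, hpole⟩
  -- The subtracted values `ε x` lie in `O` and are fixed by both substitutions, so they can be
  -- added back after reduction.
  have hmem : ∀ x (hx : x ∈ s), (((θ₂.comp θ₁).comp ρ) x,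
      f' ⟨x, hx⟩ + RatFunc.C (IsLocalRing.residue O (ε x))) ∈
        reductionRelation (algebraMap O E) (IsLocalRing.residue O) := by
    intro x hx
    convert Subring.add_mem _ (hθ₂ ⟨x, hx⟩) (C_mem_reductionRelation (ε x)) using 1
    refine Prod.ext ?_ rfl
    simp only [map_sub, hθ₁C, hθ₂C, RingHom.comp_apply, Prod.fst_add]
    exact (sub_add_cancel _ _).symm
  have hC : ∀ b, ((θ₂.comp θ₁).comp ρ) (algebraMap B A b) = RatFunc.C (algebraMap O E (β b)) := by
    intro b
    simp only [RingHom.comp_apply, hρ, hθ₁C, hθ₂C]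
    rfl
  have hinj : Function.Injective (algebraMap O E) := Subtype.val_injective
  obtain ⟨ψ, hψ⟩ := exists_reduction hinj _ β hC hs fun x hx ↦ ⟨_, hmem x hx⟩
  refine ⟨ψ, fun b ↦ ?_, x₁, fun e he ↦ ?_⟩
  · refine eq_of_mem_reductionRelation hinj (hψ _) ?_
    rw [hC]
    exact C_mem_reductionRelation (β b)
  · have := eq_of_mem_reductionRelation hinj (hψ x₁) (hmem x₁ hx₁s)
    refine hx₁ (e - IsLocalRing.residue O (ε x₁)) ?_
    rw [map_sub, ← he, this, add_sub_cancel_right]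

/-- Let `R` be a valuation ring with fraction field `K`. The residue field of a valuation ring
dominating `R` in an algebraic extension of `K` is algebraic over that of `R`. -/
theorem isAlgebraic_residueField_of_valuationRing {R K E : Type*} [CommRing R] [IsDomain R]
    [ValuationRing R] [Field K] [Algebra R K] [IsFractionRing R K] [Field E] [Algebra K E]
    [Algebra.IsAlgebraic K E] (O : ValuationSubring E) [Algebra R O] [IsLocalHom (algebraMap R O)]
    (hRO : ∀ r, ((algebraMap R O r : O) : E) = algebraMap K E (algebraMap R K r)) :
    Algebra.IsAlgebraic (IsLocalRing.ResidueField R) (IsLocalRing.ResidueField O) := by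
  classical
  let : Algebra R E := ((algebraMap K E).comp (algebraMap R K)).toAlgebra
  have : IsScalarTower R K E := .of_algebraMap_eq fun _ ↦ rfl
  refine ⟨fun y ↦ ?_⟩
  obtain ⟨x, rfl⟩ := IsLocalRing.residue_surjective y
  have halg : IsAlgebraic R (x : E) := by
    rw [IsFractionRing.isAlgebraic_iff R K E]
    exact Algebra.IsAlgebraic.isAlgebraic _
  obtain ⟨p, hp, hpx⟩ := halg
  -- divide `p` by a coefficient of minimal valuation
  obtain ⟨i, hi, hmin⟩ : ∃ i ∈ p.support, ∀ j ∈ p.support, p.coeff i ∣ p.coeff j := by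
    obtain ⟨i, hi, hmax⟩ := Finset.exists_max_image p.support
      (fun i ↦ ValuationRing.valuation R K (algebraMap R K (p.coeff i)))
      (by simpa [Finset.nonempty_iff_ne_empty] using hp)
    refine ⟨i, hi, fun j hj ↦ ?_⟩
    obtain ⟨r, hr⟩ := (hmax j hj : _ ≤ _)
    refine ⟨r, IsFractionRing.injective R K ?_⟩
    rw [map_mul, mul_comm, ← hr, Algebra.smul_def]
  choose f hf using fun j ↦ (show p.coeff i ∣ p.coeff j by
    by_cases hj : j ∈ p.support
    · exact hmin j hj
    · simp [notMem_support_iff.1 hj])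
  have hci : p.coeff i ≠ 0 := mem_support_iff.1 hi
  let p' : R[X] := ∑ j ∈ p.support, monomial j (f j)
  have hpp' : C (p.coeff i) * p' = p := by
    conv_rhs => rw [p.as_sum_support]
    rw [Finset.mul_sum]
    refine Finset.sum_congr rfl fun j _ ↦ ?_
    rw [C_mul_monomial, ← hf j]
  have hp'i : p'.coeff i = 1 := by
    have := congrArg (coeff · i) hpp'
    simp only [coeff_C_mul] at this
    exact mul_left_cancel₀ hci (by rw [this, mul_one])
  have hx0 : aeval x p' = 0 := by
    have h1 : algebraMap R E (p.coeff i) * aeval (x : E) p' = 0 := by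
      rw [← hpx, ← hpp', map_mul, aeval_C, hpp']
    have h2 : aeval (x : E) p' = 0 := by
      refine (mul_eq_zero.1 h1).resolve_left ?_
      rw [IsScalarTower.algebraMap_apply R K E]
      simpa using hci
    apply Subtype.val_injective
    have h3 : ((aeval x p' : O) : E) = aeval (x : E) p' := by
      rw [aeval_def, aeval_def]
      change O.subtype _ = _
      rw [hom_eval₂]
      congr 1
      ext r
      exact hRO r
    rw [h3, h2]
    rfl
  -- Having a coefficient equal to one, `p'` stays nonzero over the residue field.
  refine ⟨p'.map (IsLocalRing.residue R), fun h ↦ ?_, ?_⟩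
  · have := congrArg (coeff · i) h
    simp [coeff_map, hp'i] at this
  · rw [aeval_def, eval₂_map]
    have : (algebraMap (IsLocalRing.ResidueField R) (IsLocalRing.ResidueField O)).comp
        (IsLocalRing.residue R) = (IsLocalRing.residue O).comp (algebraMap R O) := by
      ext r
      rfl
    rw [this, ← hom_eval₂, ← aeval_def, hx0, map_zero]

end Specialization

/-! ### Affine schemes, the affine line and generic fibers. -/

section SpecMap

variable {R S T : Type u} [CommRing R] [CommRing S] [CommRing T]

/-- The morphism of affine schemes induced by an unbundled ring homomorphism. -/
noncomputable abbrev specMap (φ : R →+* S) :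
    Spec (CommRingCat.of S) ⟶ Spec (CommRingCat.of R) :=
  Spec.map (CommRingCat.ofHom φ)

lemma specMap_comp (φ : R →+* S) (ψ : S →+* T) : specMap (ψ.comp φ) = specMap ψ ≫ specMap φ := by
  rw [specMap, CommRingCat.ofHom_comp, Spec.map_comp]

lemma specMap_comp_eq {φ : R →+* S} {ψ : S →+* T} {χ : R →+* T} (h : ψ.comp φ = χ) :
    specMap ψ ≫ specMap φ = specMap χ := by
  rw [← h, specMap_comp]

lemma specMap_inj {φ ψ : R →+* S} : specMap φ = specMap ψ ↔ φ = ψ :=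
  ⟨fun h ↦ congrArg CommRingCat.Hom.hom (Spec.map_injective h), fun h ↦ h ▸ rfl⟩

lemma exists_specMap (g : Spec (CommRingCat.of S) ⟶ Spec (CommRingCat.of R)) :
    ∃ φ : R →+* S, specMap φ = g := by
  obtain ⟨φ, rfl⟩ := Spec.map_surjective g
  exact ⟨φ.hom, rfl⟩

lemma isDominant_specMap {φ : R →+* S} (h : Function.Injective φ) : IsDominant (specMap φ) :=
  ⟨(PrimeSpectrum.denseRange_comap_iff_ker_le_nilRadical φ).2 (by
    rw [(RingHom.injective_iff_ker_eq_bot φ).1 h]; exact bot_le)⟩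

end SpecMap

section AffineLine

variable (k : Type u) [Field k]

/-- The affine line over a field is a Dedekind scheme. -/
instance isDedekindScheme_spec_polynomial : IsDedekindScheme (Spec (CommRingCat.of k[X])) where
  isIntegrallyClosed_stalk s := by
    let p : PrimeSpectrum k[X] := s
    exact isIntegrallyClosed_of_isLocalization (R := k[X])
      ((Spec.structureSheaf k[X]).presheaf.stalk p)
      p.asIdeal.primeCompl p.asIdeal.primeCompl_le_nonZeroDivisors
  topologicalKrullDim_eq_one := by
    have := PrimeSpectrum.topologicalKrullDim_eq_ringKrullDim k[X]
    rw [IsPrincipalIdealRing.ringKrullDim_eq_one _ (Polynomial.not_isField k)] at this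
    exact this

/-- The generic point of the spectrum of a domain `R` is the spectrum of any fraction field. -/
lemma exists_iso_functionField_aux (R : CommRingCat.{u}) [IsDomain R] (F : Type u) [Field F]
    [Algebra R F] [IsFractionRing R F] :
    ∃ e : Spec (CommRingCat.of F) ≅ Spec (Spec R).functionField,
      e.hom ≫ genericPointMap (Spec R) = Spec.map (CommRingCat.ofHom (algebraMap R F)) := by
  let e : (Spec R).functionField ≃ₐ[R] F :=
    IsLocalization.algEquiv (nonZeroDivisors R) (Spec R).functionField F
  let e' : Spec (CommRingCat.of F) ≅ Spec (Spec R).functionField :=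
    Scheme.Spec.mapIso (e.toRingEquiv.toCommRingCatIso).op
  refine ⟨e', ?_⟩
  have h1 : genericPointMap (Spec R) =
      Spec.map (CommRingCat.ofHom (algebraMap R (Spec R).functionField)) := by
    rw [genericPointMap, Spec.fromSpecStalk_eq']
    rfl
  have h2 : e'.hom = Spec.map (CommRingCat.ofHom e.toRingEquiv.toRingHom) := rfl
  rw [h1, h2, ← Spec.map_comp]
  congr 1
  ext x
  exact e.commutes x

lemma exists_iso_functionField (R F : Type u) [CommRing R] [IsDomain R] [Field F] [Algebra R F]
    [IsFractionRing R F] :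
    ∃ e : Spec (CommRingCat.of F) ≅ Spec (Spec (CommRingCat.of R)).functionField,
      e.hom ≫ genericPointMap (Spec (CommRingCat.of R)) = specMap (algebraMap R F) :=
  have : IsDomain (CommRingCat.of R) := inferInstanceAs (IsDomain R)
  exists_iso_functionField_aux (CommRingCat.of R) F

lemma exists_factor_genericPointMap {R L : Type u} [CommRing R] [IsDomain R] [Field L]
    {φ : R →+* L} (hφ : Function.Injective φ) :
    ∃ t : Spec (CommRingCat.of L) ⟶ Spec (Spec (CommRingCat.of R)).functionField,
      t ≫ genericPointMap (Spec (CommRingCat.of R)) = specMap φ := by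
  obtain ⟨e, he⟩ := exists_iso_functionField R (FractionRing R)
  refine ⟨specMap (IsFractionRing.lift hφ) ≫ e.hom, ?_⟩
  rw [Category.assoc, he]
  exact specMap_comp_eq (RingHom.ext fun x ↦ IsFractionRing.lift_algebraMap hφ x)

/-- A nonzero function on an integral affine scheme does not vanish on generic fibers. -/
lemma notMem_of_genericFiber {R : Type u} [CommRing R] [IsDomain R] {Z : Scheme.{u}}
    (z : Z ⟶ Spec (CommRingCat.of R)) {r : R} (hr : r ≠ 0) (x : genericFiber z) :
    r ∉ ((genericFiberι z ≫ z) x : PrimeSpectrum R).asIdeal := by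
  obtain ⟨e, he⟩ := exists_iso_functionField R (FractionRing R)
  have h : genericFiberι z ≫ z =
      (genericFiberToSpec z ≫ e.inv) ≫ specMap (algebraMap R (FractionRing R)) := by
    rw [Category.assoc, ← he, e.inv_hom_id_assoc]
    exact pullback.condition
  rw [h, Scheme.Hom.comp_apply]
  intro hmem
  have hmem' : algebraMap R (FractionRing R) r ∈
      ((genericFiberToSpec z ≫ e.inv) x : PrimeSpectrum (FractionRing R)).asIdeal := hmem
  refine PrimeSpectrum.isPrime _ |>.ne_top (Ideal.eq_top_of_isUnit_mem _ hmem' ?_)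
  exact isUnit_iff_ne_zero.2 (by simpa using hr)

end AffineLine

section GenericFiber

variable {X S T : Scheme.{u}} [IsIntegral S] {f : X ⟶ S}

lemma genericFiber_condition (f : X ⟶ S) :
    genericFiberι f ≫ f = genericFiberToSpec f ≫ genericPointMap S :=
  pullback.condition

/-- The morphism to the generic fiber induced by its universal property. -/
noncomputable def genericFiberLift (a : T ⟶ X) (b : T ⟶ Spec S.functionField)
    (h : a ≫ f = b ≫ genericPointMap S) : T ⟶ genericFiber f :=
  pullback.lift a b h

lemma genericFiberLift_ι (a : T ⟶ X) (b : T ⟶ Spec S.functionField)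
    (h : a ≫ f = b ≫ genericPointMap S) : genericFiberLift a b h ≫ genericFiberι f = a :=
  pullback.lift_fst _ _ _

lemma genericFiberLift_toSpec (a : T ⟶ X) (b : T ⟶ Spec S.functionField)
    (h : a ≫ f = b ≫ genericPointMap S) : genericFiberLift a b h ≫ genericFiberToSpec f = b :=
  pullback.lift_snd _ _ _

end GenericFiber

/-! ### The weak extension property over an affine line makes rational curves constant. -/

section WeakExtension

variable {Y S S' : Scheme.{u}} [IsIntegral S']

/-- The weak extension property of a base change, in terms of morphisms to the original scheme. -/
lemma WeakExtensionProperty.exists_extension {f : Y ⟶ S} {g : S' ⟶ S}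
    (hf : WeakExtensionProperty (pullback.snd f g)) {Z : Scheme.{u}} (z : Z ⟶ S') [hz : Smooth z]
    (w : genericFiber z ⟶ Y) (hw : w ≫ f = genericFiberι z ≫ z ≫ g) :
    ∃ v : Z ⟶ Y, v ≫ f = z ≫ g ∧ genericFiberι z ≫ v = w := by
  let w' : genericFiber z ⟶ pullback f g :=
    pullback.lift w (genericFiberι z ≫ z) (by rw [hw, Category.assoc])
  have hw' : w' ≫ pullback.snd f g = genericFiberToSpec z ≫ genericPointMap S' := by
    rw [pullback.lift_snd]
    exact genericFiber_condition z
  obtain ⟨v, hv, hv'⟩ := hf Z z hz (genericFiberLift w' (genericFiberToSpec z) hw')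
    (genericFiberLift_toSpec _ _ _)
  refine ⟨v ≫ pullback.fst f g, ?_, ?_⟩
  · rw [Category.assoc, pullback.condition, reassoc_of% hv]
  · rw [reassoc_of% hv', ← Category.assoc, genericFiberLift_ι, pullback.lift_fst]

variable {k : Type u} [Field k]

/-- A rational map from the affine line over `k` to a scheme satisfying the weak extension
property over the affine line extends. -/
lemma WeakExtensionProperty.exists_extension_of_ratFunc {f : Y ⟶ S}
    {h : Spec (CommRingCat.of k) ⟶ S}
    (hf : WeakExtensionProperty (pullback.snd f (specMap (C : k →+* k[X]) ≫ h)))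
    (χ : Spec (CommRingCat.of (RatFunc k)) ⟶ Y) (hχ : χ ≫ f = specMap RatFunc.C ≫ h) :
    ∃ v : Spec (CommRingCat.of k[X]) ⟶ Y, v ≫ f = specMap C ≫ h ∧
      specMap (algebraMap k[X] (RatFunc k)) ≫ v = χ := by
  obtain ⟨e, he⟩ := exists_iso_functionField k[X] (RatFunc k)
  have hcond := genericFiber_condition (𝟙 (Spec (CommRingCat.of k[X])))
  have hC : specMap (RatFunc.C (K := k)) = specMap (algebraMap k[X] (RatFunc k)) ≫ specMap C :=
    (specMap_comp_eq (RingHom.ext fun x ↦ RatFunc.algebraMap_C x)).symm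
  -- The smooth test scheme is the affine line itself, whose generic fiber is the spectrum of
  -- `k(X)`.
  obtain ⟨v, hv, hv'⟩ := hf.exists_extension (𝟙 _) (genericFiberToSpec (𝟙 _) ≫ e.inv ≫ χ) (by
    rw [Category.assoc, Category.assoc, hχ, hC, ← he]
    simp only [Category.assoc, e.inv_hom_id_assoc, Category.id_comp]
    rw [← reassoc_of% hcond])
  refine ⟨v, by simpa using hv, ?_⟩
  rw [← genericFiberLift_ι (f := 𝟙 _) (specMap (algebraMap k[X] (RatFunc k))) e.hom
    (by rw [he, Category.comp_id]), Category.assoc, hv', ← Category.assoc, genericFiberLift_toSpec,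
    e.hom_inv_id_assoc]

/-- Allows the affine plane as a test scheme over the affine line. -/
instance smooth_specMap_polynomial (R : Type u) [CommRing R] : Smooth (specMap (C : R →+* R[X])) := by
  rw [HasRingHomProperty.Spec_iff (P := @Smooth)]
  exact RingHom.smooth_algebraMap.2 ⟨inferInstance, inferInstance⟩

/-- A morphism from the affine line over `k` to a separated scheme satisfying the weak extension
property over the affine line is constant: extend the composite with the division of coordinates
`t / T` to the affine plane and restrict to the line `T = 0`. -/
lemma WeakExtensionProperty.exists_factor_of_affineLine {f : Y ⟶ S} [IsSeparated f]
    {h : Spec (CommRingCat.of k) ⟶ S}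
    (hf : WeakExtensionProperty (pullback.snd f (specMap (C : k →+* k[X]) ≫ h)))
    (v : Spec (CommRingCat.of k[X]) ⟶ Y) (hv : v ≫ f = specMap C ≫ h) :
    ∃ y : Spec (CommRingCat.of k) ⟶ Y, v = specMap C ≫ y := by
  -- The inner variable is the base parameter `T`, named `r` in the plane; the outer variable is
  -- `t`. On the generic fiber of `z` the function `T` is invertible, so `t / T` makes sense there.
  let z : Spec (CommRingCat.of k[X][X]) ⟶ Spec (CommRingCat.of k[X]) := specMap (C : k[X] →+* k[X][X])
  let r : k[X][X] := C X
  let Pr := Localization.Away r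
  let L := FractionRing k[X][X]
  have hopen : IsOpenImmersion (specMap (algebraMap k[X][X] Pr)) :=
    IsOpenImmersion.of_isLocalization r
  have hrange : Set.range (genericFiberι z) ⊆ Set.range (specMap (algebraMap k[X][X] Pr)) := by
    rintro _ ⟨x, rfl⟩
    have h1 := notMem_of_genericFiber z (X_ne_zero (R := k)) x
    rw [Scheme.Hom.comp_apply] at h1
    have h2 : Set.range (specMap (algebraMap k[X][X] Pr)) =
        (PrimeSpectrum.basicOpen r : Set (PrimeSpectrum k[X][X])) :=
      PrimeSpectrum.localization_away_comap_range Pr r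
    rw [h2]
    exact h1
  let a : genericFiber z ⟶ Spec (CommRingCat.of Pr) :=
    IsOpenImmersion.lift (specMap (algebraMap k[X][X] Pr)) (genericFiberι z) hrange
  have ha : a ≫ specMap (algebraMap k[X][X] Pr) = genericFiberι z := IsOpenImmersion.lift_fac _ _ _
  -- the quotient of the two coordinates
  let δ : k[X] →+* Pr := eval₂RingHom ((algebraMap k[X][X] Pr).comp ((C : k[X] →+* k[X][X]).comp C))
    (algebraMap k[X][X] Pr X * IsLocalization.Away.invSelf r)
  have hδC : δ.comp C = (algebraMap k[X][X] Pr).comp ((C : k[X] →+* k[X][X]).comp C) := by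
    ext x
    simp [δ]
  obtain ⟨V, hVf, hV⟩ := hf.exists_extension z (a ≫ specMap δ ≫ v) (by
    have h1 : specMap δ ≫ specMap C =
        specMap (algebraMap k[X][X] Pr) ≫ specMap (C : k[X] →+* k[X][X]) ≫ specMap C := by
      rw [specMap_comp_eq hδC, specMap_comp_eq (φ := C) (ψ := (C : k[X] →+* k[X][X])) rfl,
        specMap_comp_eq rfl]
    rw [Category.assoc, Category.assoc, hv, reassoc_of% h1, reassoc_of% ha])
  -- multiplication of the coordinate by the parameter
  let m : k[X][X] →+* k[X][X] := eval₂RingHom C (X * C X)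
  have hmC : m.comp C = C := by
    ext x <;> simp [m]
  have hzm : specMap m ≫ z = z := specMap_comp_eq hmC
  -- This is `V(tT, T) = v(t)`. As `f` is separated, it suffices to compare at the generic point of
  -- the plane, where `V` is given by the quotient of its coordinates.
  have key : specMap m ≫ V = specMap (mapRingHom C) ≫ v := by
    let η : k[X][X] →+* L := algebraMap k[X][X] L
    have hη : Function.Injective η := IsFractionRing.injective k[X][X] L
    have hdom := isDominant_specMap hη
    refine ext_of_isDominant_of_isSeparated f ?_ (specMap η) ?_
    · have h1 : specMap (mapRingHom (C : k →+* k[X])) ≫ specMap C = z ≫ specMap (C : k →+* k[X]) := by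
        rw [specMap_comp_eq (φ := C) (ψ := (C : k[X] →+* k[X][X])) rfl]
        refine specMap_comp_eq ?_
        ext x
        simp
      rw [Category.assoc, hVf, reassoc_of% hzm, Category.assoc, hv, reassoc_of% h1]
    · obtain ⟨t, ht⟩ := exists_factor_genericPointMap (φ := η.comp C)
        (hη.comp Polynomial.C_injective)
      let ℓ : Spec (CommRingCat.of L) ⟶ genericFiber z := genericFiberLift (specMap η ≫ specMap m) t
        (by rw [Category.assoc, hzm, ht]; exact specMap_comp_eq rfl)
      have hℓ : ℓ ≫ genericFiberι z = specMap η ≫ specMap m := genericFiberLift_ι _ _ _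
      obtain ⟨θ, hθ⟩ := exists_specMap (ℓ ≫ a)
      have hθ' : θ.comp (algebraMap k[X][X] Pr) = η.comp m := by
        rw [← specMap_inj, specMap_comp (algebraMap k[X][X] Pr) θ, specMap_comp m η, hθ, Category.assoc,
          ha, hℓ]
      have hθδ : θ.comp δ = η.comp (mapRingHom C) := by
        have h1 : ∀ p, θ (algebraMap k[X][X] Pr p) = η (m p) := fun p ↦ congrArg (· p) hθ'
        ext x
        · simp [δ, h1, m]
        · have h2 : θ (algebraMap k[X][X] Pr r) * θ (IsLocalization.Away.invSelf r) = 1 := by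
            rw [← map_mul, IsLocalization.Away.mul_invSelf, map_one]
          rw [h1] at h2
          have h3 : m X = m r * 0 + X * r := by simp [m, r]
          have h4 : m r = r := by simp [m, r]
          rw [h4] at h2
          simp only [δ, RingHom.comp_apply, coe_eval₂RingHom, eval₂_X, map_mul, h1, h3, mul_zero,
            zero_add, coe_mapRingHom, map_X]
          rw [mul_assoc, h2, mul_one]
      rw [← Category.assoc, ← hℓ, Category.assoc, hV, ← Category.assoc ℓ, ← hθ, ← Category.assoc,
        ← Category.assoc, ← specMap_comp, ← specMap_comp, hθδ]
  -- Restriction to the line `T = 0`: there `(tT, T)` collapses to the origin while `v(t)` is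
  -- unchanged.
  let ζ : k[X][X] →+* k[X] := mapRingHom (evalRingHom 0)
  have hζ₁ : ζ.comp (mapRingHom C) = RingHom.id _ := by
    ext x <;> simp [ζ]
  have hζ₂ : ζ.comp m = C.comp ((evalRingHom 0).comp (evalRingHom 0)) := by
    ext x <;> simp [ζ, m]
  have hid : specMap (RingHom.id k[X]) = 𝟙 _ := Spec.map_id _
  refine ⟨specMap ((evalRingHom (0 : k)).comp (evalRingHom 0)) ≫ V, ?_⟩
  rw [← Category.assoc, ← specMap_comp, ← hζ₂, specMap_comp, Category.assoc, key, ← Category.assoc,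
    ← specMap_comp, hζ₁, hid, Category.id_comp]

/-- A point with values in `k(T)` of a scheme over `k` satisfying the weak extension property over
the affine line is defined over `k`. -/
theorem WeakExtensionProperty.exists_factor_of_ratFunc {f : Y ⟶ S} [IsSeparated f]
    {h : Spec (CommRingCat.of k) ⟶ S}
    (hf : WeakExtensionProperty (pullback.snd f (specMap (C : k →+* k[X]) ≫ h)))
    (χ : Spec (CommRingCat.of (RatFunc k)) ⟶ Y) (hχ : χ ≫ f = specMap RatFunc.C ≫ h) :
    ∃ y : Spec (CommRingCat.of k) ⟶ Y, χ = specMap RatFunc.C ≫ y := by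
  obtain ⟨v, hv, rfl⟩ := hf.exists_extension_of_ratFunc χ hχ
  obtain ⟨y, rfl⟩ := hf.exists_factor_of_affineLine v hv
  refine ⟨y, ?_⟩
  rw [← Category.assoc, specMap_comp_eq (RingHom.ext fun x ↦ RatFunc.algebraMap_C x)]

end WeakExtension

/-! ### Local rings of Dedekind schemes. -/

section Stalk

/-- The local rings of a Dedekind scheme are valuation rings. -/
lemma valuationRing_stalk (S : Scheme.{u}) [IsDedekindScheme S] (s : S) :
    ValuationRing (S.presheaf.stalk s) := by
  have h₁ : ringKrullDim (S.presheaf.stalk s) ≤ 1 := by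
    rw [← IsDedekindScheme.topologicalKrullDim_eq_one (S := S),
      ← PrimeSpectrum.topologicalKrullDim_eq_ringKrullDim]
    -- The spectrum of the local ring embeds topologically in `S`, so its dimension is at most one.
    exact (S.fromSpecStalk s).isEmbedding.isInducing.topologicalKrullDim_le
  have h₂ : Ring.KrullDimLE 1 (S.presheaf.stalk s) := Ring.krullDimLE_iff.2 h₁
  have h₃ := IsDedekindScheme.isIntegrallyClosed_stalk s
  have h₄ := (tfae_of_isNoetherianRing_of_isLocalRing_of_isDomain (S.presheaf.stalk s)).out 1 3
  refine h₄.2 ⟨h₃, fun P hP hP' ↦ ?_⟩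
  exact IsLocalRing.eq_maximalIdeal (hP'.isMaximal_of_ne_bot hP)

lemma exists_isClosed_singleton (S : Scheme.{u}) [Nonempty S] [CompactSpace S] :
    ∃ s : S, IsClosed ({s} : Set S) := by
  obtain ⟨s, -, hs⟩ := IsClosed.exists_closed_singleton (X := S) isClosed_univ
    Set.univ_nonempty
  exact ⟨s, hs⟩

lemma specMap_algebraMap_stalk (S : Scheme.{u}) [IsIntegral S] (s : S) :
    specMap (algebraMap (S.presheaf.stalk s) S.functionField) ≫ S.fromSpecStalk s =
      genericPointMap S :=
  Scheme.SpecMap_stalkSpecializes_fromSpecStalk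
    ((genericPoint_spec S).specializes trivial)

end Stalk

/-! ### The affine line as a chart of the projective line. -/

section Chart

attribute [local instance] MvPolynomial.gradedAlgebra

variable (k : Type u) [Field k]

/-- Setting `T₀ = X` and `T₁ = 1`. -/
noncomputable def dehomogenize : MvPolynomial (Fin 2) k →ₐ[k] k[X] := MvPolynomial.aeval ![X, 1]

variable {k}

/-- In a fixed degree a monomial is determined by its exponent of `T₀`, so setting `T₁ = 1` causes
no cancellation. -/
lemma eq_zero_of_dehomogenize_eq_zero {n : ℕ} {p : MvPolynomial (Fin 2) k}
    (hp : p.IsHomogeneous n) (h : dehomogenize k p = 0) : p = 0 := by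
  classical
  ext d
  rw [MvPolynomial.coeff_zero]
  by_contra hd
  have hdeg : ∀ e, p.coeff e ≠ 0 → e 0 + e 1 = n := by
    intro e he
    have := hp he
    rw [Finsupp.weight_apply, Finsupp.sum_fintype _ _ (by simp)] at this
    simpa using this
  have hcoeff : (dehomogenize k p).coeff (d 0) = p.coeff d := by
    rw [dehomogenize, MvPolynomial.aeval_def, MvPolynomial.eval₂_eq', finsetSum_coeff,
      Finset.sum_eq_single d]
    · simp
    · intro e he hed
      simp only [Fin.prod_univ_two, Matrix.cons_val_zero, Matrix.cons_val_one, one_pow, mul_one,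
        algebraMap_eq, coeff_C_mul, coeff_X_pow]
      rw [if_neg, mul_zero]
      intro h0
      refine hed (Finsupp.ext fun i ↦ ?_)
      have h1 := hdeg e (MvPolynomial.mem_support_iff.1 he)
      have h2 := hdeg d hd
      fin_cases i
      · exact h0.symm
      · simp; omega
    · intro h'
      exact absurd (MvPolynomial.notMem_support_iff.1 h') hd
  rw [h, coeff_zero] at hcoeff
  exact hd hcoeff.symm

variable (k)

/-- The coordinate ring of the chart `T₁ ≠ 0` of the projective line maps to `k[X]`. -/
noncomputable def chartRingHom :
    HomogeneousLocalization.Away (MvPolynomial.homogeneousSubmodule (Fin 2) k)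
      (MvPolynomial.X 1) →+* k[X] :=
  (IsLocalization.Away.lift (S := Localization.Away (MvPolynomial.X 1 : MvPolynomial (Fin 2) k))
    (MvPolynomial.X 1) (g := (dehomogenize k).toRingHom) (by simp [dehomogenize])).comp
    (algebraMap _ _)

lemma isHomogeneous_X_mem (i : Fin 2) :
    (MvPolynomial.X i : MvPolynomial (Fin 2) k) ∈ MvPolynomial.homogeneousSubmodule (Fin 2) k 1 :=
  MvPolynomial.isHomogeneous_X k i

lemma chartRingHom_mk (n : ℕ) (p : MvPolynomial (Fin 2) k)
    (hp : p ∈ MvPolynomial.homogeneousSubmodule (Fin 2) k (n • 1)) :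
    chartRingHom k (HomogeneousLocalization.Away.mk _ (isHomogeneous_X_mem k 1) n p hp) =
      dehomogenize k p := by
  rw [chartRingHom, RingHom.comp_apply, HomogeneousLocalization.algebraMap_apply,
    HomogeneousLocalization.Away.val_mk, Localization.mk_eq_mk', IsLocalization.Away.lift,
    IsLocalization.lift_mk'_spec]
  simp [dehomogenize]

lemma chartRingHom_algebraMap (e : k) :
    chartRingHom k (HomogeneousLocalization.fromZeroRingHom _ _
      (algebraMap k (MvPolynomial.homogeneousSubmodule (Fin 2) k 0) e)) = C e := by
  have h := chartRingHom_mk k 0 (MvPolynomial.C e) (by simp)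
  have h' : dehomogenize k (MvPolynomial.C e) = C e := by
    simp [dehomogenize, algebraMap_eq]
  rw [← h', ← h]
  congr 1

lemma chartRingHom_bijective : Function.Bijective (chartRingHom k) := by
  constructor
  · rw [injective_iff_map_eq_zero]
    intro x hx
    obtain ⟨n, p, hp, rfl⟩ :=
      HomogeneousLocalization.Away.mk_surjective _ (isHomogeneous_X_mem k 1) x
    rw [chartRingHom_mk] at hx
    have hp0 := eq_zero_of_dehomogenize_eq_zero hp hx
    subst hp0
    apply HomogeneousLocalization.val_injective
    rw [HomogeneousLocalization.Away.val_mk, Localization.mk_zero,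
      HomogeneousLocalization.val_zero]
  · intro p
    change p ∈ (chartRingHom k).range
    induction p using Polynomial.induction_on' with
    | add p q hp hq => exact add_mem hp hq
    | monomial n e =>
      have hX : (X : k[X]) ∈ (chartRingHom k).range :=
        ⟨_, (chartRingHom_mk k 1 (MvPolynomial.X 0) (isHomogeneous_X_mem k 0)).trans
          (by simp [dehomogenize])⟩
      have hC : C e ∈ (chartRingHom k).range := ⟨_, chartRingHom_algebraMap k e⟩
      rw [← C_mul_X_pow_eq_monomial]
      exact mul_mem hC (pow_mem hX n)

lemma exists_chart_proj :
    ∃ α : Spec (CommRingCat.of k[X]) ⟶ Proj (MvPolynomial.homogeneousSubmodule (Fin 2) k),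
      IsOpenImmersion α ∧ α ≫ Proj.toSpecZero (MvPolynomial.homogeneousSubmodule (Fin 2) k) ≫
        specMap (algebraMap k (MvPolynomial.homogeneousSubmodule (Fin 2) k 0)) = specMap C := by
  have : IsIso (CommRingCat.ofHom (chartRingHom k)) :=
    (ConcreteCategory.isIso_iff_bijective _).2 (chartRingHom_bijective k)
  have h : IsOpenImmersion (specMap (chartRingHom k)) := inferInstance
  have h' : IsOpenImmersion (Proj.awayι (MvPolynomial.homogeneousSubmodule (Fin 2) k)
    (MvPolynomial.X 1) (isHomogeneous_X_mem k 1) one_pos) := inferInstance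
  refine ⟨specMap (chartRingHom k) ≫
    Proj.awayι (MvPolynomial.homogeneousSubmodule (Fin 2) k) (MvPolynomial.X 1)
      (isHomogeneous_X_mem k 1) one_pos, inferInstance, ?_⟩
  rw [Category.assoc, Proj.awayι_toSpecZero_assoc]
  refine (congrArg _ (specMap_comp_eq rfl)).trans (specMap_comp_eq ?_)
  refine RingHom.ext fun e ↦ ?_
  exact chartRingHom_algebraMap k e

/-- The affine line as an open subscheme of the projective line. -/
theorem exists_chart : ∃ α : Spec (CommRingCat.of k[X]) ⟶ projectiveLine k,
    IsOpenImmersion α ∧ α ≫ projectiveLineToSpec k = specMap C :=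
  exists_chart_proj k

end Chart

/-! ### Affine charts and morphisms from local schemes. -/

section AffineChart

/-- Compatible affine charts of the source and the target of a morphism locally of finite type. -/
lemma exists_affine_charts {X S : Scheme.{u}} (f : X ⟶ S) [LocallyOfFiniteType f] (x : X) :
    ∃ (A B : Type u) (_ : CommRing A) (_ : CommRing B) (a : Spec (CommRingCat.of A) ⟶ X)
      (b : Spec (CommRingCat.of B) ⟶ S) (φ : B →+* A), IsOpenImmersion a ∧ IsOpenImmersion b ∧
      x ∈ Set.range a ∧ specMap φ ≫ b = a ≫ f ∧ φ.FiniteType := by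
  obtain ⟨W, hW, hxW, -⟩ := exists_isAffineOpen_mem_and_subset (x := f x) (U := ⊤) trivial
  obtain ⟨V, hV, hxV, hVW⟩ := exists_isAffineOpen_mem_and_subset (x := x) (U := f ⁻¹ᵁ W) hxW
  refine ⟨Γ(X, V), Γ(S, W), inferInstance, inferInstance, hV.fromSpec, hW.fromSpec,
    (f.appLE W V hVW).hom, inferInstance, inferInstance, ?_, hW.SpecMap_appLE_fromSpec f hV hVW,
    f.finiteType_appLE hW hV hVW⟩
  rw [hV.range_fromSpec]
  exact hxV

/-- A morphism from a local scheme which sends the closed point to an affine chart is induced by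
a ring homomorphism. -/
lemma exists_specMap_comp_eq {X : Scheme.{u}} {A R : Type u} [CommRing A] [CommRing R]
    [IsLocalRing R] (a : Spec (CommRingCat.of A) ⟶ X) [IsOpenImmersion a]
    (l : Spec (CommRingCat.of R) ⟶ X) (hl : l (IsLocalRing.closedPoint R) ∈ Set.range a) :
    ∃ ε : A →+* R, specMap ε ≫ a = l := by
  have h : l ⁻¹ᵁ a.opensRange = ⊤ := Scheme.preimage_eq_top_of_closedPoint_mem l hl
  have hr : Set.range l ⊆ Set.range a := by
    rintro _ ⟨x, rfl⟩
    have hx : x ∈ l ⁻¹ᵁ a.opensRange := h ▸ trivial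
    exact hx
  obtain ⟨ε, hε⟩ := exists_specMap (IsOpenImmersion.lift a l hr)
  exact ⟨ε, by rw [hε, IsOpenImmersion.lift_fac]⟩

lemma specMap_comp_inj {X : Scheme.{u}} {A R : Type u} [CommRing A] [CommRing R]
    (a : Spec (CommRingCat.of A) ⟶ X) [Mono a] {φ ψ : A →+* R}
    (h : specMap φ ≫ a = specMap ψ ≫ a) : φ = ψ :=
  specMap_inj.1 ((cancel_mono a).1 h)

end AffineChart

/-! ### Rational curves in closed fibers. -/

section SpecialFiber

variable {X S : Scheme.{u}} {f : X ⟶ S} {s : S}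

/-- The inclusion of a closed point is a closed immersion, and a finite field extension is of finite
type. Hence the need for a closed `s` and for descent to a finite extension. -/
lemma locallyOfFiniteType_of_isClosed {k : Type u} [Field k] (hs : IsClosed ({s} : Set S))
    [Algebra (IsLocalRing.ResidueField (S.presheaf.stalk s)) k]
    [FiniteDimensional (IsLocalRing.ResidueField (S.presheaf.stalk s)) k] :
    LocallyOfFiniteType (specMap (algebraMap (IsLocalRing.ResidueField (S.presheaf.stalk s)) k) ≫
      specMap (IsLocalRing.residue (S.presheaf.stalk s)) ≫ S.fromSpecStalk s) := by
  have h₁ : LocallyOfFiniteType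
      (specMap (algebraMap (IsLocalRing.ResidueField (S.presheaf.stalk s)) k)) := by
    rw [HasRingHomProperty.Spec_iff (P := @LocallyOfFiniteType)]
    exact RingHom.finiteType_algebraMap.2 inferInstance
  have h₂ : IsClosedImmersion (S.fromSpecResidueField s) :=
    isClosed_singleton_iff_isClosedImmersion.1 hs
  have h₃ : LocallyOfFiniteType (S.fromSpecResidueField s) := inferInstance
  exact MorphismProperty.comp_mem @LocallyOfFiniteType _ (S.fromSpecResidueField s) h₁ h₃

/-- Points with values in `k(T)` of closed fibers of schemes with the universal weak extension
property are constant. -/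
lemma UniversalWeakExtensionProperty.exists_eq_C [IsIntegral S]
    (hX : UniversalWeakExtensionProperty f)
    [IsSeparated f] (hs : IsClosed ({s} : Set S)) {k A B : Type u} [CommRing A] [CommRing B]
    (a : Spec (CommRingCat.of A) ⟶ X) [IsOpenImmersion a] (b : Spec (CommRingCat.of B) ⟶ S)
    {φ : B →+* A} (hφ : φ.FiniteType) (hab : specMap φ ≫ b = a ≫ f)
    {γ : B →+* S.presheaf.stalk s} (hγ : specMap γ ≫ b = S.fromSpecStalk s) [Field k]
    [Algebra (IsLocalRing.ResidueField (S.presheaf.stalk s)) k]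
    [Algebra.IsAlgebraic (IsLocalRing.ResidueField (S.presheaf.stalk s)) k]
    (ψ : A →+* RatFunc k) (hψ : ∀ x, ψ (φ x) = RatFunc.C (algebraMap _ k
      (IsLocalRing.residue (S.presheaf.stalk s) (γ x)))) (x : A) : ∃ e, ψ x = RatFunc.C e := by
  by_contra! hx
  algebraize [φ]
  obtain ⟨k', hk', ψ', hψ', x', hx'⟩ := exists_descent ψ ((IsLocalRing.residue _).comp γ) hψ ⟨x, hx⟩
  let h : Spec (CommRingCat.of k') ⟶ S :=
    specMap (algebraMap (IsLocalRing.ResidueField (S.presheaf.stalk s)) k') ≫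
      specMap (IsLocalRing.residue (S.presheaf.stalk s)) ≫ S.fromSpecStalk s
  have hh : LocallyOfFiniteType h := locallyOfFiniteType_of_isClosed hs
  have hC : LocallyOfFiniteType (specMap (C : k' →+* k'[X])) := inferInstance
  have hg : LocallyOfFiniteType (specMap (C : k' →+* k'[X]) ≫ h) :=
    MorphismProperty.comp_mem @LocallyOfFiniteType _ _ hC hh
  have hqc : QuasiCompact (specMap (C : k' →+* k'[X]) ≫ h) :=
    quasiCompact_of_noetherianSpace_source _
  have hχ : (specMap ψ' ≫ a) ≫ f = specMap RatFunc.C ≫ h := by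
    have h₁ : ψ'.comp φ = RatFunc.C.comp ((algebraMap _ k').comp
      ((IsLocalRing.residue (S.presheaf.stalk s)).comp γ)) := RingHom.ext hψ'
    rw [Category.assoc, ← hab, ← Category.assoc, specMap_comp_eq h₁, specMap_comp, specMap_comp,
      specMap_comp]
    simp only [Category.assoc, hγ, h]
  obtain ⟨y, hy⟩ := (hX.2 _ _ hg hqc).exists_factor_of_ratFunc _ hχ
  -- The image point of `y` is that of the `k'(T)`-point, which lies in the chart, so constancy can
  -- be read off in `A`.
  obtain ⟨r, hr⟩ := exists_specMap_comp_eq a y (by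
    let p : Spec (CommRingCat.of (RatFunc k')) := IsLocalRing.closedPoint (RatFunc k')
    refine ⟨specMap ψ' p, ?_⟩
    rw [← Scheme.Hom.comp_apply, hy, Scheme.Hom.comp_apply]
    exact congrArg y (Subsingleton.elim (α := PrimeSpectrum k') _ _))
  have hψr : ψ' = RatFunc.C.comp r := by
    refine specMap_comp_inj a ?_
    rw [hy, specMap_comp, Category.assoc, hr]
  exact hx' (r x') (congrArg (· x') hψr)

end SpecialFiber

/-! ### Specializing a point of the curve, and the germ of the curve there. -/

section Specialization

/-- The valuative criterion for points with values in an extension of the function field. -/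
lemma exists_valuationSubring_lift {X S : Scheme.{u}} [IsIntegral S] (f : X ⟶ S) [IsProper f]
    {E : Type u} [Field E] [Algebra S.functionField E] (t : Spec (CommRingCat.of E) ⟶ X)
    (ht : t ≫ f = specMap (algebraMap S.functionField E) ≫ genericPointMap S) (s : S) :
    ∃ (O : ValuationSubring E) (j : S.presheaf.stalk s →+* O) (l : Spec (CommRingCat.of O) ⟶ X),
      IsLocalHom j ∧
      (∀ r, (j r : E) = algebraMap S.functionField E (algebraMap _ S.functionField r)) ∧
      specMap O.subtype ≫ l = t ∧ l ≫ f = specMap j ≫ S.fromSpecStalk s := by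
  obtain ⟨O, hO, hloc⟩ := IsLocalRing.exists_factor_valuationRing
    ((algebraMap S.functionField E).comp (algebraMap (S.presheaf.stalk s) S.functionField))
  let j : S.presheaf.stalk s →+* O := RingHom.codRestrict _ O.toSubring hO
  have hw : t ≫ f = specMap (algebraMap O E) ≫ specMap j ≫ S.fromSpecStalk s := by
    rw [ht, ← specMap_algebraMap_stalk S s, ← Category.assoc, ← Category.assoc]
    congr 1
    exact (specMap_comp _ _).symm.trans (specMap_comp j O.subtype)
  have hf : ValuativeCriterion f := by
    have h : IsProper f := inferInstance
    rw [IsProper.eq_valuativeCriterion] at h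
    exact h.1.1.1
  obtain ⟨l, hl₁, hl₂⟩ := (hf.existence { R := O, K := E, commSq := ⟨hw⟩, .. }).exists_lift
  exact ⟨O, j, l, hloc, fun _ ↦ rfl, hl₁, hl₂⟩

variable {E G : Type u} [Field E] [CommRing G] [Algebra E[X] G]

/-- Near a point of an open subscheme of the affine line, a morphism is given by regular
functions. -/
lemma exists_ratFunc_of_eval {Y : Scheme.{u}} (g : E[X]) [IsLocalization.Away g G]
    (w : Spec (CommRingCat.of G) ⟶ Y) {c : E} {ev : G →+* E}
    (hev : ev.comp (algebraMap E[X] G) = evalRingHom c) {ι : G →+* RatFunc E}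
    (hι : ι.comp (algebraMap E[X] G) = algebraMap E[X] (RatFunc E)) {A : Type u} [CommRing A]
    (a : Spec (CommRingCat.of A) ⟶ Y) [IsOpenImmersion a] {θ : A →+* E}
    (hθ : specMap ev ≫ w = specMap θ ≫ a) :
    ∃ ρ : A →+* RatFunc E, specMap ρ ≫ a = specMap ι ≫ w ∧
      ∀ x, (ρ x, θ x) ∈ evaluationRelation c := by
  -- Pass to the local ring of the line at `c`: its closed point maps into the chart because the
  -- value at `c` does, so the whole local scheme does.
  let P : Ideal E[X] := RingHom.ker (evalRingHom c)
  have hP : P.IsPrime := RingHom.ker_isPrime _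
  have hmem : ∀ q : P.primeCompl, (q : E[X]).eval c ≠ 0 := fun q hq ↦ q.2 hq
  have hgc : g.eval c ≠ 0 := by
    have h := (IsLocalization.Away.algebraMap_isUnit (S := G) g).map ev
    rw [← RingHom.comp_apply, hev] at h
    exact h.ne_zero
  let Q := Localization.AtPrime P
  let u₀ : G →+* Q := IsLocalization.Away.lift g (g := algebraMap E[X] Q)
    (IsLocalization.map_units Q (⟨g, hgc⟩ : P.primeCompl))
  let u₁ : Q →+* RatFunc E := IsLocalization.lift (M := P.primeCompl)
    (g := algebraMap E[X] (RatFunc E)) fun q ↦ by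
      rw [isUnit_iff_ne_zero, Ne, FaithfulSMul.algebraMap_eq_zero_iff]
      intro hq
      exact hmem q (by rw [hq, eval_zero])
  let u₂ : Q →+* E := IsLocalization.lift (M := P.primeCompl) (g := evalRingHom c) fun q ↦
    isUnit_iff_ne_zero.2 (hmem q)
  have hu₀ : u₀.comp (algebraMap E[X] G) = algebraMap E[X] Q := IsLocalization.Away.lift_comp g _
  have hu₁ : u₁.comp (algebraMap E[X] Q) = algebraMap E[X] (RatFunc E) := IsLocalization.lift_comp _
  have hu₂ : u₂.comp (algebraMap E[X] Q) = evalRingHom c := IsLocalization.lift_comp _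
  have h₁ : u₁.comp u₀ = ι := by
    refine IsLocalization.ringHom_ext (Submonoid.powers g) ?_
    rw [RingHom.comp_assoc, hu₀, hu₁, hι]
  have h₂ : u₂.comp u₀ = ev := by
    refine IsLocalization.ringHom_ext (Submonoid.powers g) ?_
    rw [RingHom.comp_assoc, hu₀, hu₂, hev]
  have hsurj : Function.Surjective u₂ := fun e ↦
    ⟨algebraMap E[X] Q (C e), by rw [← RingHom.comp_apply, hu₂]; simp⟩
  have hu₂' : IsLocalHom u₂ := .of_surjective _ hsurj
  have hfac : specMap u₂ ≫ specMap u₀ ≫ w = specMap θ ≫ a := by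
    rw [← Category.assoc, specMap_comp_eq h₂, hθ]
  obtain ⟨Λ, hΛ⟩ := exists_specMap_comp_eq a (specMap u₀ ≫ w) (by
    have h : specMap u₂ (IsLocalRing.closedPoint E) = IsLocalRing.closedPoint Q :=
      IsLocalRing.comap_closedPoint u₂
    rw [← h]
    let p : Spec (CommRingCat.of E) := IsLocalRing.closedPoint E
    refine ⟨specMap θ p, ?_⟩
    change a (specMap θ p) = (specMap u₀ ≫ w) (specMap u₂ p)
    rw [← Scheme.Hom.comp_apply, ← hfac, Scheme.Hom.comp_apply])
  have hθ' : u₂.comp Λ = θ := by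
    refine specMap_comp_inj a ?_
    rw [specMap_comp, Category.assoc, hΛ, hfac]
  refine ⟨u₁.comp Λ, ?_, fun x ↦ ?_⟩
  · rw [specMap_comp, Category.assoc, hΛ, ← Category.assoc, specMap_comp_eq h₁]
  · obtain ⟨⟨p, q⟩, hpq⟩ := IsLocalization.surj P.primeCompl (Λ x)
    refine mem_evaluationRelation.2 ⟨p, q, hmem q, ?_, ?_⟩
    · rw [← hu₁]
      simpa using congrArg u₁ hpq
    · rw [← hθ']
      have h := congrArg u₂ hpq
      rw [map_mul, ← RingHom.comp_apply u₂ (algebraMap E[X] Q),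
        ← RingHom.comp_apply u₂ (algebraMap E[X] Q), hu₂] at h
      exact h

end Specialization

/-! ### Constancy of maps from open parts of the line, and the conclusion. -/

section RationalCurve

variable {X S : Scheme.{u}} [IsDedekindScheme S] {f : X ⟶ S}

/-- An open subscheme of the affine line over an algebraic closure of the function field admits
only constant morphisms to a proper scheme with the universal weak extension property. -/
theorem UniversalWeakExtensionProperty.eq_const [IsProper f]
    (hX : UniversalWeakExtensionProperty f)
    {E G : Type u} [Field E] [IsAlgClosed E] [Algebra S.functionField E]
    [Algebra.IsAlgebraic S.functionField E] [CommRing G] [Algebra E[X] G] {g : E[X]} (hg : g ≠ 0)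
    [IsLocalization.Away g G] {c : E} {ev : G →+* E}
    (hev : ev.comp (algebraMap E[X] G) = evalRingHom c) (w : Spec (CommRingCat.of G) ⟶ X)
    (hw : w ≫ f = specMap ((algebraMap E[X] G).comp C) ≫
      specMap (algebraMap S.functionField E) ≫ genericPointMap S) :
    w = specMap ((algebraMap E[X] G).comp C) ≫ specMap ev ≫ w := by
  have hevC : ev.comp ((algebraMap E[X] G).comp C) = RingHom.id E := by
    rw [← RingHom.comp_assoc, hev]
    ext e
    simp
  have hid : specMap ev ≫ specMap ((algebraMap E[X] G).comp C) = 𝟙 _ :=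
    (specMap_comp_eq hevC).trans (Spec.map_id _)
  have ht : (specMap ev ≫ w) ≫ f =
      specMap (algebraMap S.functionField E) ≫ genericPointMap S := by
    rw [Category.assoc, hw, reassoc_of% hid]
  obtain ⟨s, hs⟩ := exists_isClosed_singleton S
  obtain ⟨O, j, l, hj, hjO, hlt, hlf⟩ := exists_valuationSubring_lift f (specMap ev ≫ w) ht s
  -- A chart at the specialization of `w(c)` contains the whole `O`-point, hence also `w(c)` and the
  -- germ of `w` at `c`.
  obtain ⟨A, B, _, _, a, b, φ, ha, hb, hla, hab, hφ⟩ :=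
    exists_affine_charts f (l (IsLocalRing.closedPoint O))
  obtain ⟨ε, hε⟩ := exists_specMap_comp_eq a l hla
  have hsb : S.fromSpecStalk s (IsLocalRing.closedPoint (S.presheaf.stalk s)) ∈ Set.range b := by
    obtain ⟨z, hz⟩ := hla
    let p : Spec (CommRingCat.of O) := IsLocalRing.closedPoint O
    have h : specMap j p = IsLocalRing.closedPoint (S.presheaf.stalk s) :=
      IsLocalRing.comap_closedPoint j
    refine ⟨specMap φ z, ?_⟩
    rw [← h]
    change a z = l p at hz
    rw [← Scheme.Hom.comp_apply, hab, Scheme.Hom.comp_apply, hz, ← Scheme.Hom.comp_apply, hlf,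
      Scheme.Hom.comp_apply]
  let i : Spec (CommRingCat.of (S.presheaf.stalk s)) ⟶ S := S.fromSpecStalk s
  obtain ⟨γ, hγ⟩ : ∃ γ : B →+* S.presheaf.stalk s, specMap γ ≫ b = S.fromSpecStalk s :=
    exists_specMap_comp_eq b i hsb
  have hεφ : ε.comp φ = j.comp γ := by
    refine specMap_comp_inj b ?_
    rw [specMap_comp, Category.assoc, hab, ← Category.assoc, hε, hlf, specMap_comp, Category.assoc,
      hγ]
  have hgM : Submonoid.powers g ≤ nonZeroDivisors E[X] := powers_le_nonZeroDivisors_of_noZeroDivisors hg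
  have hdomain : IsDomain G := IsLocalization.isDomain_of_le_nonZeroDivisors G hgM
  let ι : G →+* RatFunc E := IsLocalization.Away.lift g (g := algebraMap E[X] (RatFunc E))
    (isUnit_iff_ne_zero.2 (by simpa using hg))
  have hι : ι.comp (algebraMap E[X] G) = algebraMap E[X] (RatFunc E) :=
    IsLocalization.Away.lift_comp g _
  have hιinj : Function.Injective ι := by
    rw [injective_iff_map_eq_zero]
    intro x hx
    obtain ⟨⟨p, q⟩, hpq⟩ := IsLocalization.surj (Submonoid.powers g) x
    have h := congrArg ι hpq
    rw [map_mul, hx, zero_mul, ← RingHom.comp_apply ι (algebraMap E[X] G), hι] at h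
    have hp : p = 0 := RatFunc.algebraMap_injective E (by rw [← h, map_zero])
    rw [hp, map_zero] at hpq
    exact ((IsLocalization.map_units G q).mul_left_eq_zero).1 hpq
  have hdom := isDominant_specMap hιinj
  obtain ⟨ρ, hρ, hρε⟩ := exists_ratFunc_of_eval g w hev hι a (θ := O.subtype.comp ε)
    (by rw [specMap_comp, Category.assoc, hε, hlt])
  have hιC : ι.comp ((algebraMap E[X] G).comp C) = RatFunc.C := by
    rw [← RingHom.comp_assoc, hι]
    ext e
    simp
  have hρφ : ρ.comp φ = RatFunc.C.comp (O.subtype.comp (j.comp γ)) := by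
    refine specMap_comp_inj b ?_
    rw [specMap_comp, Category.assoc, hab, reassoc_of% hρ, hw, ← Category.assoc, specMap_comp_eq hιC,
      specMap_comp, Category.assoc, ← ht, specMap_comp, specMap_comp]
    simp only [Category.assoc, hγ]
    rw [← hlf, reassoc_of% hlt]
  have hconst : ∀ x, ∃ e, ρ x = RatFunc.C e := by
    by_contra! hnc
    algebraize [φ]
    obtain ⟨ψ, hψ, x, hx⟩ := exists_nonconstant_specialization O (j.comp γ) ε ρ
      (fun y ↦ congrArg (· y) hρφ) hρε hnc
    let _ : Algebra (S.presheaf.stalk s) O := j.toAlgebra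
    have hloc : IsLocalHom (algebraMap (S.presheaf.stalk s) O) := hj
    have hval := valuationRing_stalk S s
    have halg := isAlgebraic_residueField_of_valuationRing O hjO
    obtain ⟨e, he⟩ := hX.exists_eq_C hs a b hφ hab hγ ψ hψ x
    exact hx e he
  -- A constant rational function equals its value at `c`.
  have hρ' : ρ = RatFunc.C.comp (O.subtype.comp ε) := by
    ext x
    obtain ⟨e, he⟩ := hconst x
    have h := Subring.sub_mem _ (hρε x) (C_mem_evaluationRelation c e)
    obtain ⟨p, q, hq, h₁, h₂⟩ := mem_evaluationRelation.1 h
    simp only [Prod.fst_sub, he, sub_self, zero_mul, Prod.snd_sub] at h₁ h₂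
    have hp : p = 0 := RatFunc.algebraMap_injective E (by rw [← h₁, map_zero])
    rw [hp, eval_zero, mul_eq_zero, or_iff_left hq, sub_eq_zero] at h₂
    rw [he, ← h₂]
    rfl
  refine ext_of_isDominant_of_isSeparated f ?_ (specMap ι) ?_
  · rw [Category.assoc, ht, hw]
  · rw [← hρ, ← Category.assoc, specMap_comp_eq hιC, hρ', specMap_comp, specMap_comp, Category.assoc,
      Category.assoc, hε, hlt]

end RationalCurve

/-- A rational curve contains a nonempty basic open subscheme of the affine line. -/
lemma ContainsRationalCurve.exists_mono {k : Type u} [Field k] [IsAlgClosed k] {V : Scheme.{u}}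
    {p : V ⟶ Spec (CommRingCat.of k)} (h : ContainsRationalCurve k p) :
    ∃ (g : k[X]) (i : Spec (CommRingCat.of (Localization.Away g)) ⟶ V), g ≠ 0 ∧ Mono i ∧
      i ≫ p = specMap ((algebraMap k[X] (Localization.Away g)).comp C) := by
  obtain ⟨U, i, hU, hi, hip⟩ := h
  obtain ⟨α, hα, hαp⟩ := exists_chart k
  -- The dense open `U` meets the affine chart; shrink to a basic open subset of the intersection.
  obtain ⟨y, ⟨z, rfl⟩, hyU⟩ := hU.inter_open_nonempty _ α.isOpenEmbedding.isOpen_range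
    ⟨_, (⟨⊥, Ideal.isPrime_bot⟩ : PrimeSpectrum k[X]), rfl⟩
  obtain ⟨_, ⟨g, rfl⟩, hzg, hgU⟩ :=
    PrimeSpectrum.isTopologicalBasis_basic_opens.exists_subset_of_mem_open
      (u := (α ⁻¹ᵁ U).1) hyU (α ⁻¹ᵁ U).2
  let δ := specMap (algebraMap k[X] (Localization.Away g))
  have hδ : IsOpenImmersion δ := IsOpenImmersion.of_isLocalization g
  have hrange : Set.range (δ ≫ α) ⊆ Set.range U.ι := by
    rw [Scheme.Opens.range_ι]
    rintro _ ⟨x, rfl⟩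
    have hx : δ x ∈ Set.range δ := ⟨x, rfl⟩
    have h₂ : Set.range δ = (PrimeSpectrum.basicOpen g : Set (PrimeSpectrum k[X])) :=
      PrimeSpectrum.localization_away_comap_range (Localization.Away g) g
    rw [h₂] at hx
    rw [Scheme.Hom.comp_apply]
    exact hgU hx
  let a := IsOpenImmersion.lift U.ι (δ ≫ α) hrange
  have ha : a ≫ U.ι = δ ≫ α := IsOpenImmersion.lift_fac _ _ _
  have hmono : Mono (a ≫ U.ι) := ha ▸ inferInstance
  have hmono' : Mono a := mono_of_mono a U.ι
  refine ⟨g, a ≫ i, ?_, inferInstance, ?_⟩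
  · rintro rfl
    exact hzg (Ideal.zero_mem _)
  · rw [Category.assoc, hip, reassoc_of% ha, hαp]
    exact (specMap_comp _ _).symm

/-- An open subscheme of the affine line over an algebraic closure of the function field admits no
monomorphism to the geometric generic fiber of a proper scheme with the universal weak extension
property. -/
theorem UniversalWeakExtensionProperty.not_mono {X S : Scheme.{u}} [IsDedekindScheme S]
    {f : X ⟶ S} [IsProper f] (hX : UniversalWeakExtensionProperty f) {Y V : Scheme.{u}} {j : Y ⟶ X}
    {q : Y ⟶ Spec S.functionField} (hj : IsPullback j q f (genericPointMap S)) {E : Type u} [Field E]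
    [IsAlgClosed E] [Algebra S.functionField E] [Algebra.IsAlgebraic S.functionField E] {π : V ⟶ Y}
    {p : V ⟶ Spec (CommRingCat.of E)} {κ : Spec (CommRingCat.of E) ⟶ Spec S.functionField}
    (hκ : κ = specMap (algebraMap S.functionField E)) (hπ : IsPullback π p q κ) {g : E[X]} (hg : g ≠ 0)
    (i : Spec (CommRingCat.of (Localization.Away g)) ⟶ V)
    (hip : i ≫ p = specMap ((algebraMap E[X] (Localization.Away g)).comp C)) : ¬ Mono i := by
  intro hi
  let G := Localization.Away g
  obtain ⟨c, hc⟩ : ∃ c, g.eval c ≠ 0 := by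
    by_contra! h
    exact hg (Polynomial.funext fun c ↦ by rw [h, eval_zero])
  let ev : G →+* E := IsLocalization.Away.lift g (g := evalRingHom c) (isUnit_iff_ne_zero.2 hc)
  have hev : ev.comp (algebraMap E[X] G) = evalRingHom c := IsLocalization.Away.lift_comp g _
  have hconst := hX.eq_const hg hev (i ≫ π ≫ j) (by
    rw [Category.assoc, Category.assoc, hj.w, reassoc_of% hπ.w, reassoc_of% hip, hκ])
  have hevC : ev.comp ((algebraMap E[X] G).comp C) = RingHom.id E := by
    rw [← RingHom.comp_assoc, hev]
    ext e
    simp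
  have hid : specMap ev ≫ specMap ((algebraMap E[X] G).comp C) = 𝟙 _ :=
    (specMap_comp_eq hevC).trans (Spec.map_id _)
  -- A morphism to `V` is determined by its components to `X` and to the two field spectra, so
  -- constancy in `X` lifts to `V`.
  have h₁ : i = specMap ((algebraMap E[X] G).comp C) ≫ specMap ev ≫ i := by
    refine hπ.hom_ext (hj.hom_ext ?_ ?_) ?_
    · simpa only [Category.assoc] using hconst
    · simp only [Category.assoc]
      rw [hπ.w, reassoc_of% hip, reassoc_of% hid]
    · simp only [Category.assoc]
      rw [hip, hid, Category.comp_id]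
  -- Cancelling the monomorphism `i`, the identity of `G` factors through evaluation at `c`, which
  -- would make the coordinate equal to `c`.
  have h₂ : RingHom.id G = ((algebraMap E[X] G).comp C).comp ev := by
    refine specMap_comp_inj i ?_
    rw [specMap_comp, Category.assoc, ← h₁]
    exact (congrArg (· ≫ i) (Spec.map_id _)).trans (Category.id_comp i)
  have h₃ : algebraMap E[X] G Polynomial.X = algebraMap E[X] G (C c) := by
    have h := congrArg (· (algebraMap E[X] G Polynomial.X)) h₂
    simp only [RingHom.comp_apply, RingHom.id_apply] at h
    rw [h, ← RingHom.comp_apply ev, hev, coe_evalRingHom, eval_X]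
  exact X_ne_C c
    (IsLocalization.injective G (powers_le_nonZeroDivisors_of_noZeroDivisors hg) h₃)

end PseudoNeron

theorem mainTheorem10 (S : Scheme.{u}) [PseudoNeron.IsDedekindScheme S]
    -- `XK` is a smooth and separated scheme of finite type over the function field `K` of `S`
    (XK : Scheme.{u}) (q : XK ⟶ Spec S.functionField)
    [Smooth q] [IsSeparated q] [LocallyOfFiniteType q] [QuasiCompact q]
    -- `X` is a proper (flat) `S`-model of `XK`
    (X : Scheme.{u}) (f : X ⟶ S) [IsProper f] [Flat f]
    (j : XK ⟶ X) (hj : IsPullback j q f (PseudoNeron.genericPointMap S))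
    (hX : PseudoNeron.UniversalWeakExtensionProperty f) :
    ¬ PseudoNeron.ContainsRationalCurve (AlgebraicClosure S.functionField)
      (PseudoNeron.geometricFiberToSpec S.functionField q) := by
  intro hcurve
  obtain ⟨g, i, hg, hi, hip⟩ := hcurve.exists_mono
  exact hX.not_mono hj rfl (IsPullback.of_hasPullback q _) hg i hip hi
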